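/- Let $Q$ be a finite poset with $n$ elements, and let $J(Q)$ be the distributive lattice of order ideals (down-sets) of $Q$, ordered by inclusion; it is graded of rank $n$, with rank function $\rho$. For $S\subseteq[n-1]=\{1,\dots,n-1\}$ let $\alpha(S)$ be the number of chains $C$ of $J(Q)$ with $\{\rho(t): t\in C\}=S$, and let $\beta(S)=\sum_{T\subseteq S}(-1)^{\#(S-T)}\alpha(T)$ (the flag $h$-vector of $J(Q)$). The following conditions are equivalent. (a) The flag $h$-vector of $J(Q)$ is multiplicity-free, i.e., $\beta(S)\in\{0,1,-1\}$ for all $S\subseteq[n-1]$. (b) For $0\le i\le n$, $J(Q)$ has at most two elements of rank $i$. Equivalently, $Q$ has at most two $i$-element order ideals for each $0\le i\le n$. (c) $Q$ is $(\mathbf 2+\mathbf 2)$-free (it has no induced subposet isomorphic to the disjoint union of two 2-element chains) and $(\mathbf 1+\mathbf 1+\mathbf 1)$-free (it has no 3-element antichain). If these conditions hold and $\beta(S)\ne0$ for some $S\subseteq[n-1]$, then $S$ is sparse, i.e., contains no two consecutive integers. Moreover, if $f(n)$ is the number of $n$-element posets, up to isomorphism, that satisfy these conditions, then $$\sum_{n\ge0}f(n)x^n=\frac{1-2x}{(1-x)(1-2x-x^2)}.$$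 A poset is a nontrivial ordinal sum if it is isomorphic to the ordinal sum of two nonempty posets. An $n$-element poset $Q$ satisfying the conditions above is not a nontrivial ordinal sum if and only if $J(Q)$ has exactly two elements of each rank $1\le i\le n-1$. If $g(n)$ is the number, up to isomorphism, of $n$-element posets that satisfy the conditions and are not nontrivial ordinal sums, then $g(1)=g(2)=1$ and $g(n)=2^{n-3}$ for $n\ge3$. -/

import Mathlib

universe u

noncomputable section

/-- The rank `ρ(t)` of an element `t` of a finite graded poset with least element: the length of
a longest chain that ends in `t`. -/
def posetRank {P : Type*} [PartialOrder P] (t : P) : ℕ :=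
  (Order.height t).toNat

/-- The flag `f`-vector `α_P` of a finite graded poset: `α_P(S)` is the number of chains `C`
of `P` whose set of ranks is `S`. -/
def flagFVector (P : Type*) [PartialOrder P] (S : Finset ℕ) : ℕ :=
  {C : Set P | IsChain (· ≤ ·) C ∧ posetRank '' C = (S : Set ℕ)}.ncard

/-- The flag `h`-vector `β_P(S) = ∑_{T ⊆ S} (-1)^{#(S - T)} α_P(T)`. -/
def flagHVector (P : Type*) [PartialOrder P] (S : Finset ℕ) : ℤ :=
  ∑ T ∈ S.powerset, (-1 : ℤ) ^ (S \ T).card * (flagFVector P T : ℤ)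

/-- `β_P` is multiplicity-free: it takes only the values `0, 1, -1` on the subsets of
`[n - 1] = {i | 0 < i < n}`, where `n`, the rank of `P`, is the rank of its top element. -/
def FlagHMultiplicityFree (P : Type*) [PartialOrder P] [BoundedOrder P] : Prop :=
  ∀ S : Finset ℕ, S ⊆ Finset.Ioo 0 (posetRank (⊤ : P)) →
    flagHVector P S = 0 ∨ flagHVector P S = 1 ∨ flagHVector P S = -1

/-- A set of integers is sparse if it does not contain two consecutive integers. -/
def IsSparse (S : Finset ℕ) : Prop :=
  ∀ i : ℕ, ¬ (i ∈ S ∧ i + 1 ∈ S)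

/-- `Q` has no induced subposet isomorphic to the disjoint union of two 2-element chains. -/
def TwoPlusTwoFree (Q : Type*) [PartialOrder Q] : Prop :=
  IsEmpty ((Fin 2 ⊕ Fin 2) ↪o Q)

/-- `Q` has no 3-element antichain. -/
def OnePlusOnePlusOneFree (Q : Type*) [PartialOrder Q] : Prop :=
  ¬ ∃ A : Finset Q, A.card = 3 ∧ IsAntichain (· ≤ ·) (A : Set Q)

/-- `Q` is a nontrivial ordinal sum: it is isomorphic to the ordinal sum of two nonempty posets
(`A ⊕ₗ B` is the disjoint union in which every element of `A` lies below every element of `B`). -/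
def IsNontrivialOrdinalSum (Q : Type u) [PartialOrder Q] : Prop :=
  ∃ (A B : Type u) (_ : PartialOrder A) (_ : PartialOrder B),
    Nonempty A ∧ Nonempty B ∧ Nonempty (Q ≃o A ⊕ₗ B)

/-- The poset `J(Q)` of order ideals (down-sets) of `Q`, which is Mathlib's `LowerSet Q` ordered
by inclusion, has a multiplicity-free flag `h`-vector. -/
def IdealsMultiplicityFree (Q : Type*) [PartialOrder Q] : Prop :=
  FlagHMultiplicityFree (LowerSet Q)

/-- Isomorphism of partial orders on the set `{0, …, n - 1}`. -/
def posetIsoSetoid (n : ℕ) : Setoid (PartialOrder (Fin n)) where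
  r p q := Nonempty (@OrderIso (Fin n) (Fin n) p.toLE q.toLE)
  iseqv :=
    { refl := fun p => ⟨@OrderIso.refl (Fin n) p.toLE⟩
      symm := fun {p q} ⟨e⟩ => ⟨@OrderIso.symm (Fin n) (Fin n) p.toLE q.toLE e⟩
      trans := fun {p q r} ⟨e⟩ ⟨e'⟩ =>
        ⟨@OrderIso.trans (Fin n) (Fin n) (Fin n) p.toLE q.toLE r.toLE e e'⟩ }

/-- The number of isomorphism classes of `n`-element posets that contain a partial order on
`{0, …, n - 1}` with the property `Φ`. -/
def countPosetsUpToIso (n : ℕ) (Φ : PartialOrder (Fin n) → Prop) : ℕ :=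
  (Quotient.mk (posetIsoSetoid n) '' {p | Φ p}).ncard

/-- `f(n)`: the number of nonisomorphic `n`-element posets `Q` for which the flag `h`-vector of
`J(Q)` is multiplicity-free. -/
def fCount (n : ℕ) : ℕ :=
  countPosetsUpToIso n fun p => @IdealsMultiplicityFree (Fin n) p

/-- `g(n)`: the number of those posets that are not a nontrivial ordinal sum. -/
def gCount (n : ℕ) : ℕ :=
  countPosetsUpToIso n fun p =>
    @IdealsMultiplicityFree (Fin n) p ∧ ¬ @IsNontrivialOrdinalSum (Fin n) p

end

/-! In a $(\mathbf 2+\mathbf 2)$-free poset the strict down-sets are nested, so an element with the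
largest one is maximal and lies above everything that lies below anything. If moreover there is no
3-element antichain, at most one other element is not below it. Removing such elements repeatedly
numbers the poset by 0, …, n - 1 so that k lies above all smaller numbers except at most one, `p k`
(with `p k = k` if none is omitted), and `p (k + 1)` must be `k + 1`, `k` or `p k`
(`exists_encodes`).

In such a numbering an ideal of size i is {0, …, i - 1} or {0, …, i} without `p i`
(`eq_initial_or_punctured`). A chain with rank set S is thus a choice of the ranks at which the
second kind is used. A bijection (`card_isPuncturedSet`) shows that α(S) counts the subsets of S
that are descent sets, so by Möbius inversion β is the indicator function of descent sets
(`flagHVector_eq`). Hence β takes only the values 0 and 1, and a descent set is visibly sparse.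

Conversely, β({i}) = α({i}) - 1 bounds the number of ideals of each size by two, while each
forbidden subposet produces three ideals of one size.

A nontrivial ordinal sum amounts to a rank strictly between 0 and n with a unique ideal. For the
enumeration, the numberings are normalised to `codes`, with exactly one code per isomorphism class
(`code_unique`, `nonempty_orderIso`). Classifying codes by their last values gives the recurrences
for f and g. -/

noncomputable section

/-! ### Sizes of order ideals and the rank function of J(Q) -/

namespace LowerSet

variable {Q : Type*} [PartialOrder Q]

/-- Removing from `U` a maximal element of `U \ L` leaves an ideal above `L`, one element smaller;
repeat until the size is `i`. -/
theorem exists_ncard_eq_of_le [Finite Q] (i : ℕ) (L U : LowerSet Q) (hLU : L ≤ U)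
    (hL : (L : Set Q).ncard ≤ i) (hU : i ≤ (U : Set Q).ncard) :
    ∃ I : LowerSet Q, L ≤ I ∧ I ≤ U ∧ (I : Set Q).ncard = i := by
  obtain ⟨k, hk⟩ := Nat.exists_eq_add_of_le hU
  induction k generalizing U with
  | zero => exact ⟨U, hLU, le_rfl, hk⟩
  | succ k ih =>
    have hne : ((U : Set Q) \ L).Nonempty := by
      rw [Set.nonempty_iff_ne_empty]
      intro h
      have := Set.ncard_le_ncard (Set.sdiff_eq_empty.1 h)
      omega
    obtain ⟨z, hz⟩ := (Set.toFinite ((U : Set Q) \ L)).exists_maximal hne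
    have hmax : ∀ y ∈ U, z ≤ y → y = z := fun y hy hzy =>
      le_antisymm (hz.2 ⟨hy, fun hyL => hz.1.2 (L.lower hzy hyL)⟩ hzy) hzy
    let U' : LowerSet Q := ⟨(U : Set Q) \ {z}, fun a b hba ha => ⟨U.lower hba ha.1, fun hb => by
      rw [Set.mem_singleton_iff] at hb
      exact ha.2 (hmax a ha.1 (hb ▸ hba))⟩⟩
    have hcard : (U' : Set Q).ncard + 1 = (U : Set Q).ncard :=
      Set.ncard_sdiff_singleton_add_one hz.1.1
    obtain ⟨I, h1, h2, h3⟩ := ih U' (fun y hy => ⟨hLU hy, fun h => hz.1.2 (by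
      rw [Set.mem_singleton_iff] at h; exact h ▸ hy)⟩) (by omega) (by omega)
    exact ⟨I, h1, h2.trans fun y hy => hy.1, h3⟩

theorem strictMono_ncard [Finite Q] : StrictMono fun I : LowerSet Q => (I : Set Q).ncard :=
  fun _ _ h => Set.ncard_lt_ncard (LowerSet.coe_ssubset_coe.2 h)

theorem eq_of_le_of_ncard_le [Finite Q] {I J : LowerSet Q} (h : I ≤ J)
    (hc : (J : Set Q).ncard ≤ (I : Set Q).ncard) : I = J :=
  SetLike.coe_injective (Set.eq_of_subset_of_ncard_le h hc)

theorem height_eq_ncard [Finite Q] (I : LowerSet Q) :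
    Order.height I = ((I : Set Q).ncard : ℕ∞) := by
  apply le_antisymm
  · have := Order.height_le_height_apply_of_strictMono _ strictMono_ncard I
    simpa using this
  · generalize hn : (I : Set Q).ncard = n
    induction n generalizing I with
    | zero => simp
    | succ n ih =>
      obtain ⟨J, -, h2, h3⟩ := exists_ncard_eq_of_le n ⊥ I bot_le (by simp) (by omega)
      have hlt : J < I := lt_of_le_of_ne h2 (by rintro rfl; omega)
      have h4 := Order.height_add_one_le hlt
      push_cast
      exact (add_le_add_left (ih J h3) 1).trans h4

end LowerSet

theorem posetRank_lowerSet {Q : Type*} [PartialOrder Q] [Finite Q] (I : LowerSet Q) :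
    posetRank I = (I : Set Q).ncard := by
  rw [posetRank, LowerSet.height_eq_ncard, ENat.toNat_natCast]

/-! ### Flag vectors: small rank sets and Möbius inversion -/

section flag

variable {P : Type*} [PartialOrder P]

theorem flagFVector_empty : flagFVector P ∅ = 1 := by
  have : {C : Set P | IsChain (· ≤ ·) C ∧ posetRank '' C = ((∅ : Finset ℕ) : Set ℕ)} = {∅} := by
    ext C
    simp only [Set.mem_ofPred_eq, Finset.coe_empty, Set.image_eq_empty, Set.mem_singleton_iff]
    exact ⟨And.right, fun h => ⟨h ▸ IsChain.empty, h⟩⟩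
  rw [flagFVector, this, Set.ncard_singleton]

theorem flagFVector_singleton (hinj : ∀ s t : P, s ≤ t → posetRank s = posetRank t → s = t)
    (i : ℕ) : flagFVector P {i} = {t : P | posetRank t = i}.ncard := by
  have : {C : Set P | IsChain (· ≤ ·) C ∧ posetRank '' C = (({i} : Finset ℕ) : Set ℕ)} =
      (fun t => ({t} : Set P)) '' {t : P | posetRank t = i} := by
    ext C
    simp only [Set.mem_ofPred_eq, Finset.coe_singleton, Set.mem_image]
    constructor
    · rintro ⟨hC, hi⟩
      obtain ⟨t, ht, hti⟩ : i ∈ posetRank '' C := hi ▸ rfl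
      refine ⟨t, hti, (Set.eq_singleton_iff_unique_mem.2 ⟨ht, fun s hs => ?_⟩).symm⟩
      have hsi : posetRank s = i := by
        have : posetRank s ∈ posetRank '' C := ⟨s, hs, rfl⟩
        rwa [hi] at this
      rcases hC.total hs ht with h | h
      · exact hinj _ _ h (hsi.trans hti.symm)
      · exact (hinj _ _ h (hti.trans hsi.symm)).symm
    · rintro ⟨t, ht, rfl⟩
      exact ⟨Set.subsingleton_singleton.isChain, by simp [ht]⟩
  rw [flagFVector, this, Set.ncard_image_of_injective _ Set.singleton_injective]

theorem flagHVector_singleton (hinj : ∀ s t : P, s ≤ t → posetRank s = posetRank t → s = t)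
    (i : ℕ) : flagHVector P {i} = ({t : P | posetRank t = i}.ncard : ℤ) - 1 := by
  have : (({i} : Finset ℕ)).powerset = {∅, {i}} := by
    ext s; simp [Finset.subset_singleton_iff]
  rw [flagHVector, this, Finset.sum_pair (by simp)]
  simp [flagFVector_empty, flagFVector_singleton hinj]
  ring

/-- Möbius inversion on the Boolean lattice: after exchanging the sums, the coefficient of `γ U` is
an alternating sum over the subsets of `S \ U`, which vanishes unless `U = S`. -/
theorem flagHVector_eq_of_flagFVector_eq {γ : Finset ℕ → ℤ} {S : Finset ℕ}
    (h : ∀ T ⊆ S, (flagFVector P T : ℤ) = ∑ U ∈ T.powerset, γ U) : flagHVector P S = γ S := by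
  have h1 : flagHVector P S =
      ∑ T ∈ S.powerset, ∑ U ∈ S.powerset, if U ⊆ T then (-1 : ℤ) ^ (S \ T).card * γ U else 0 := by
    refine Finset.sum_congr rfl fun T hT => ?_
    rw [h T (Finset.mem_powerset.1 hT), Finset.mul_sum, ← Finset.sum_filter]
    refine Finset.sum_congr ?_ fun _ _ => rfl
    ext U
    simp only [Finset.mem_powerset, Finset.mem_filter] at hT ⊢
    exact ⟨fun hU => ⟨hU.trans hT, hU⟩, And.right⟩
  rw [h1, Finset.sum_comm, Finset.sum_eq_single S]
  · rw [Finset.sum_eq_single S] <;> simp +contextual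
    intro T hT hne hST
    exact absurd (hT.antisymm hST) hne
  · intro U hU hne
    rw [Finset.mem_powerset] at hU
    have h2 : ∑ T ∈ S.powerset, (if U ⊆ T then (-1 : ℤ) ^ (S \ T).card * γ U else 0) =
        ∑ R ∈ (S \ U).powerset, (-1 : ℤ) ^ R.card * γ U := by
      rw [← Finset.sum_filter]
      refine Finset.sum_bij' (fun T _ => S \ T) (fun R _ => S \ R) ?_ ?_ ?_ ?_ ?_
      · intro T hT
        simp only [Finset.mem_filter, Finset.mem_powerset] at hT ⊢
        exact Finset.sdiff_subset_sdiff le_rfl hT.2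
      · intro R hR
        simp only [Finset.mem_filter, Finset.mem_powerset] at hR ⊢
        exact ⟨Finset.sdiff_subset, fun x hx => Finset.mem_sdiff.2 ⟨hU hx, fun hxR =>
          (Finset.mem_sdiff.1 (hR hxR)).2 hx⟩⟩
      · intro T hT
        simp only [Finset.mem_filter, Finset.mem_powerset] at hT
        exact Finset.sdiff_sdiff_eq_self hT.1
      · intro R hR
        exact Finset.sdiff_sdiff_eq_self ((Finset.mem_powerset.1 hR).trans Finset.sdiff_subset)
      · intro T hT
        rfl
    rw [h2, ← Finset.sum_mul, Finset.sum_powerset_neg_one_pow_card, if_neg, zero_mul]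
    intro h3
    exact hne (hU.antisymm (Finset.sdiff_eq_empty_iff_subset.1 h3))
  · simp

end flag

/-! ### Omission sequences and the ideals of an encoded poset -/

/-- An omission sequence: `p k` is `k`, `k - 1` or the previous value. -/
structure OmissionSeq (p : ℕ → ℕ) : Prop where
  zero : p 0 = 0
  succ : ∀ k, p (k + 1) = k + 1 ∨ p (k + 1) = k ∨ p (k + 1) = p k

namespace OmissionSeq

variable {p : ℕ → ℕ} (hp : OmissionSeq p)
include hp

theorem le_self (k : ℕ) : p k ≤ k := by
  induction k with
  | zero => exact hp.zero.le
  | succ k ih => rcases hp.succ k with h | h | h <;> omega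

/-- A value that is neither the index nor its predecessor is inherited, so it persists all the way
down to `s`. This is what makes the encoded relation transitive. -/
theorem eq_of_lt {s t : ℕ} (h1 : p t < s) (h2 : s ≤ t) : p s = p t := by
  induction t with
  | zero => omega
  | succ t ih =>
    rcases Nat.lt_or_ge t s with h3 | h3
    · rw [show s = t + 1 by omega]
    · rcases hp.succ t with h | h | h
      · omega
      · omega
      · rw [h] at h1 ⊢
        exact ih h1 h3

end OmissionSeq

/-- `e` identifies the poset `Q` with `{0, …, n - 1}`, where `k` lies above all smaller numbers
but `p k`. -/
structure Encodes {Q : Type*} [PartialOrder Q] (e : Q → ℕ) (n : ℕ) (p : ℕ → ℕ) : Prop where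
  inj : Function.Injective e
  lt : ∀ x, e x < n
  surj : ∀ k < n, ∃ x, e x = k
  lt_iff : ∀ x y, x < y ↔ e x < e y ∧ e x ≠ p (e y)

namespace Encodes

variable {Q : Type*} [PartialOrder Q] {e : Q → ℕ} {n : ℕ} {p : ℕ → ℕ}

theorem image_preimage (h : Encodes e n p) {s : Set ℕ} (hs : ∀ k ∈ s, k < n) :
    e '' (e ⁻¹' s) = s :=
  Set.image_preimage_eq_of_subset fun k hk => by
    obtain ⟨x, hx⟩ := h.surj k (hs k hk)
    exact ⟨x, hx⟩

theorem finite (h : Encodes e n p) : Finite Q :=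
  Finite.of_injective (fun x => (⟨e x, h.lt x⟩ : Fin n)) fun x y hxy => h.inj (by simpa using hxy)

/-- The ideal of the first `i` elements. -/
def initial (h : Encodes e n p) (i : ℕ) : LowerSet Q :=
  ⟨{x | e x < i}, fun x y hyx hx => by
    rcases hyx.eq_or_lt with rfl | hlt
    · exact hx
    · exact ((h.lt_iff _ _).1 hlt).1.trans hx⟩

theorem mem_initial (h : Encodes e n p) {i : ℕ} {x : Q} : x ∈ h.initial i ↔ e x < i := Iff.rfl

/-- The ideal of the first `i + 1` elements but the one omitted by the last of them. -/
def punctured (h : Encodes e n p) (hp : OmissionSeq p) (i : ℕ) : LowerSet Q :=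
  ⟨{x | e x ≤ i ∧ e x ≠ p i}, fun x y hyx hx => by
    rcases hyx.eq_or_lt with rfl | hlt
    · exact hx
    · obtain ⟨h1, h2⟩ := (h.lt_iff _ _).1 hlt
      refine ⟨h1.le.trans hx.1, fun h3 => h2 ?_⟩
      rw [h3, hp.eq_of_lt (h3 ▸ h1) hx.1]⟩

theorem mem_punctured (h : Encodes e n p) (hp : OmissionSeq p) {i : ℕ} {x : Q} :
    x ∈ h.punctured hp i ↔ e x ≤ i ∧ e x ≠ p i := Iff.rfl

theorem ncard_initial (h : Encodes e n p) {i : ℕ} (hi : i ≤ n) :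
    (h.initial i : Set Q).ncard = i := by
  have h1 : (h.initial i : Set Q) = e ⁻¹' (Finset.range i : Set ℕ) := by
    ext x; simp [mem_initial]
  rw [← Set.ncard_image_of_injective _ h.inj, h1, h.image_preimage (by simp; omega),
    Set.ncard_coe_finset, Finset.card_range]

theorem ncard_punctured (h : Encodes e n p) (hp : OmissionSeq p) {i : ℕ} (hi : i < n) :
    (h.punctured hp i : Set Q).ncard = i := by
  have h1 : (h.punctured hp i : Set Q) = e ⁻¹' ((Finset.range (i + 1)).erase (p i) : Finset ℕ) := by
    ext x; simp [mem_punctured, and_comm]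
  have := hp.le_self i
  rw [← Set.ncard_image_of_injective _ h.inj, h1, h.image_preimage (by simp; omega),
    Set.ncard_coe_finset, Finset.card_erase_of_mem (by simp; omega), Finset.card_range]
  rfl

theorem punctured_eq_initial (h : Encodes e n p) (hp : OmissionSeq p) {i : ℕ} (hi : p i = i) :
    h.punctured hp i = h.initial i := by
  ext x
  simp only [SetLike.mem_coe, mem_punctured, mem_initial]
  omega

theorem punctured_ne_initial (h : Encodes e n p) (hp : OmissionSeq p) {i : ℕ} (hi : i < n)
    (hpi : p i < i) : h.punctured hp i ≠ h.initial i := by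
  intro heq
  obtain ⟨x, hx⟩ := h.surj i hi
  have : x ∈ h.punctured hp i := h.mem_punctured hp |>.2 ⟨hx.le, by omega⟩
  rw [heq, mem_initial] at this
  omega

/-- The member `x` of `I` with the largest number forces every smaller number into `I` except
possibly `p (e x)`. Whether that one belongs to `I` decides between the two cases. -/
theorem eq_initial_or_punctured (h : Encodes e n p) (hp : OmissionSeq p) (I : LowerSet Q) {i : ℕ}
    (hI : (I : Set Q).ncard = i) :
    I = h.initial i ∨ i < n ∧ I = h.punctured hp i := by
  have := h.finite
  rcases (I : Set Q).eq_empty_or_nonempty with hem | hne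
  · left
    rw [hem, Set.ncard_empty] at hI
    subst hI
    ext x
    simp [hem, mem_initial]
  · obtain ⟨x, hxI, hx⟩ := (Set.toFinite (I : Set Q)).exists_maximalFor e _ hne
    have hle : ∀ y ∈ I, e y ≤ e x := fun y hy => by
      by_contra hlt
      exact hlt (hx hy (by omega))
    have hmem : ∀ y, e y ≤ e x → e y ≠ p (e x) → y ∈ I := fun y h1 h2 => by
      rcases h1.eq_or_lt with h3 | h3
      · exact h.inj h3 ▸ hxI
      · exact I.lower ((h.lt_iff _ _).2 ⟨h3, h2⟩).le hxI
    by_cases hom : ∃ y ∈ I, e y = p (e x)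
    · obtain ⟨y, hy, hyx⟩ := hom
      have heq : I = h.initial (e x + 1) := by
        ext z
        simp only [SetLike.mem_coe, mem_initial]
        refine ⟨fun hz => by have := hle z hz; omega, fun hz => ?_⟩
        by_cases hzp : e z = p (e x)
        · exact h.inj (hyx.trans hzp.symm) ▸ hy
        · exact hmem z (by omega) hzp
      have hc := h.ncard_initial (i := e x + 1) (h.lt x)
      rw [← heq, hI] at hc
      left
      rw [heq, hc]
    · push Not at hom
      have heq : I = h.punctured hp (e x) := by
        ext z
        simp only [SetLike.mem_coe, mem_punctured]
        exact ⟨fun hz => ⟨hle z hz, hom z hz⟩, fun hz => hmem z hz.1 hz.2⟩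
      have hc := h.ncard_punctured hp (i := e x) (h.lt x)
      rw [← heq, hI] at hc
      exact Or.inr ⟨hc ▸ h.lt x, hc ▸ heq⟩

theorem initial_le_initial (h : Encodes e n p) {i j : ℕ} (hij : i ≤ j) :
    h.initial i ≤ h.initial j :=
  fun _ hx => lt_of_lt_of_le (show _ < _ from hx) hij

theorem punctured_le_initial (h : Encodes e n p) (hp : OmissionSeq p) {i j : ℕ} (hij : i < j) :
    h.punctured hp i ≤ h.initial j :=
  fun _ hx => lt_of_le_of_lt (h.mem_punctured hp |>.1 hx).1 hij

theorem initial_le_punctured_iff (h : Encodes e n p) (hp : OmissionSeq p) {i j : ℕ} (hij : i < j)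
    (hj : j < n) : h.initial i ≤ h.punctured hp j ↔ i ≤ p j := by
  constructor
  · intro hle
    by_contra hlt
    obtain ⟨x, hx⟩ := h.surj (p j) ((hp.le_self j).trans_lt hj)
    exact (h.mem_punctured hp |>.1 (hle (h.mem_initial.2 (by omega : e x < i)))).2 hx
  · intro hle x hx
    have := h.mem_initial.1 hx
    exact h.mem_punctured hp |>.2 ⟨by omega, by omega⟩

/-- The only possible obstruction is the element numbered `p j`. It is absent from the smaller ideal
exactly if its number exceeds `i` or is the one omitted there. -/
theorem punctured_le_punctured_iff (h : Encodes e n p) (hp : OmissionSeq p) {i j : ℕ} (hij : i < j)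
    (hj : j < n) : h.punctured hp i ≤ h.punctured hp j ↔ i < p j ∨ p i = p j := by
  constructor
  · intro hle
    by_contra hlt
    push Not at hlt
    obtain ⟨x, hx⟩ := h.surj (p j) ((hp.le_self j).trans_lt hj)
    exact (h.mem_punctured hp |>.1
      (hle (h.mem_punctured hp |>.2 ⟨by omega, by omega⟩ : x ∈ _))).2 hx
  · intro hle x hx
    have := h.mem_punctured hp |>.1 hx
    exact h.mem_punctured hp |>.2 ⟨by omega, by omega⟩

theorem lt_iff_ncard_lowerSets_eq_two (h : Encodes e n p) (hp : OmissionSeq p) {i : ℕ} (hi : i < n) :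
    p i < i ↔ {I : LowerSet Q | (I : Set Q).ncard = i}.ncard = 2 := by
  have heq : {I : LowerSet Q | (I : Set Q).ncard = i} = {h.initial i, h.punctured hp i} := by
    ext I
    constructor
    · intro hI
      rcases h.eq_initial_or_punctured hp I hI with h1 | h1
      · exact Or.inl h1
      · exact Or.inr h1.2
    · rintro (rfl | rfl)
      · exact h.ncard_initial hi.le
      · exact h.ncard_punctured hp hi
  rw [heq]
  constructor
  · intro hlt
    exact Set.ncard_pair (h.punctured_ne_initial hp hi hlt).symm
  · intro h2
    by_contra hge
    have := hp.le_self i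
    rw [h.punctured_eq_initial hp (by omega)] at h2
    simp at h2

end Encodes

/-! ### Forbidden subposets produce three ideals of equal size -/

section forbidden

variable {Q : Type*} [PartialOrder Q]

/-- Witnesses that the strict down-sets of `x` and `y` are not nested form, together with `x` and
`y`, an induced copy of $\mathbf 2+\mathbf 2$. -/
theorem twoPlusTwoFree_iff :
    TwoPlusTwoFree Q ↔ ∀ x y : Q, (∀ a, a < x → a < y) ∨ ∀ a, a < y → a < x := by
  constructor
  · intro h x y
    by_contra! hcon
    obtain ⟨⟨a, hax, hay⟩, c, hcy, hcx⟩ := hcon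
    have h1 : ¬ a ≤ c := fun h => hay (h.trans_lt hcy)
    have h2 : ¬ c ≤ a := fun h => hcx (h.trans_lt hax)
    have h3 : ¬ y ≤ a := fun h => h2 (hcy.le.trans h)
    have h4 : ¬ x ≤ c := fun h => h1 (hax.le.trans h)
    have h5 : ¬ a ≤ y := fun h => h.lt_or_eq.elim hay fun h => h3 h.ge
    have h6 : ¬ c ≤ x := fun h => h.lt_or_eq.elim hcx fun h => h4 h.ge
    have h7 : ¬ x ≤ y := fun h => h5 (hax.le.trans h)
    have h8 : ¬ y ≤ x := fun h => h6 (hcy.le.trans h)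
    refine h.elim (OrderEmbedding.ofMapLEIff (Sum.elim ![a, x] ![c, y]) ?_)
    rintro (i | i) (j | j) <;> fin_cases i <;> fin_cases j <;>
      simp [h1, h2, h3, h4, h5, h6, h7, h8, hax.le, hcy.le, hax.not_ge, hcy.not_ge]
  · intro h
    refine ⟨fun f => ?_⟩
    have h1 : f (.inl 0) < f (.inl 1) := f.lt_iff_lt.2 (by simp)
    have h2 : f (.inr 0) < f (.inr 1) := f.lt_iff_lt.2 (by simp)
    rcases h (f (.inl 1)) (f (.inr 1)) with h3 | h3
    · simpa using f.lt_iff_lt.1 (h3 _ h1)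
    · simpa using f.lt_iff_lt.1 (h3 _ h2)

theorem onePlusOnePlusOneFree_iff :
    OnePlusOnePlusOneFree Q ↔ ∀ x y z : Q, x ≠ y → x ≠ z → y ≠ z →
      ¬ x < y → ¬ y < x → ¬ x < z → ¬ z < x → ¬ y < z → ¬ z < y → False := by
  classical
  constructor
  · intro h x y z hxy hxz hyz h1 h2 h3 h4 h5 h6
    refine h ⟨{x, y, z}, Finset.card_eq_three.2 ⟨x, y, z, hxy, hxz, hyz, rfl⟩, ?_⟩
    intro a ha b hb hab hle
    have hlt := lt_of_le_of_ne hle hab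
    simp only [Finset.coe_insert, Finset.coe_singleton, Set.mem_insert_iff,
      Set.mem_singleton_iff] at ha hb
    rcases ha with rfl | rfl | rfl <;> rcases hb with rfl | rfl | rfl <;> contradiction
  · rintro h ⟨A, hA, hanti⟩
    obtain ⟨x, y, z, hxy, hxz, hyz, rfl⟩ := Finset.card_eq_three.1 hA
    have key : ∀ a ∈ ({x, y, z} : Finset Q), ∀ b ∈ ({x, y, z} : Finset Q), ¬ a < b :=
      fun a ha b hb hlt => hanti ha hb hlt.ne hlt.le
    simp only [Finset.mem_insert, Finset.mem_singleton, forall_eq_or_imp, forall_eq] at key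
    obtain ⟨⟨-, h1, h2⟩, ⟨h3, -, h4⟩, h5, h6, -⟩ := key
    exact h x y z hxy hxz hyz h1 h3 h2 h5 h4 h6

theorem LowerSet.exists_insert (I : LowerSet Q) {x : Q} (h : ∀ y, y < x → y ∈ I) :
    ∃ J : LowerSet Q, (J : Set Q) = insert x (I : Set Q) :=
  ⟨⟨insert x (I : Set Q), fun a b hba ha => by
    rcases ha with rfl | ha
    · rcases hba.eq_or_lt with rfl | hlt
      · exact Or.inl rfl
      · exact Or.inr (h _ hlt)
    · exact Or.inr (I.lower hba ha)⟩, rfl⟩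

theorem two_lt_ncard_of_three [Finite Q] {i : ℕ} {I J K : LowerSet Q}
    (hI : (I : Set Q).ncard = i) (hJ : (J : Set Q).ncard = i) (hK : (K : Set Q).ncard = i)
    (hIJ : I ≠ J) (hIK : I ≠ K) (hJK : J ≠ K) :
    2 < {I : LowerSet Q | (I : Set Q).ncard = i}.ncard :=
  (Set.two_lt_ncard_iff (Set.toFinite _)).2 ⟨I, J, K, hI, hJ, hK, hIJ, hIK, hJK⟩

/-- Let `I` consist of all elements strictly below some member of the antichain {x, y, z}. Adding
any one of the three members to `I` gives an ideal, and these three ideals have the same size. -/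
theorem onePlusOnePlusOneFree_of_ncard_le_two [Finite Q]
    (h : ∀ i ≤ Nat.card Q, {I : LowerSet Q | (I : Set Q).ncard = i}.ncard ≤ 2) :
    OnePlusOnePlusOneFree Q := by
  rw [onePlusOnePlusOneFree_iff]
  intro x y z hxy hxz hyz h1 h2 h3 h4 h5 h6
  let I : LowerSet Q := ⟨{a | a < x ∨ a < y ∨ a < z}, fun a b hba ha =>
    ha.imp hba.trans_lt (Or.imp hba.trans_lt hba.trans_lt)⟩
  have hI : ∀ a, a ∈ I ↔ a < x ∨ a < y ∨ a < z := fun _ => Iff.rfl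
  obtain ⟨X, hX⟩ := I.exists_insert (x := x) fun a ha => Or.inl ha
  obtain ⟨Y, hY⟩ := I.exists_insert (x := y) fun a ha => Or.inr (Or.inl ha)
  obtain ⟨Z, hZ⟩ := I.exists_insert (x := z) fun a ha => Or.inr (Or.inr ha)
  have hx : x ∉ (I : Set Q) := fun h => by
    rcases (hI x).1 h with h | h | h
    exacts [lt_irrefl _ h, h1 h, h3 h]
  have hy : y ∉ (I : Set Q) := fun h => by
    rcases (hI y).1 h with h | h | h
    exacts [h2 h, lt_irrefl _ h, h5 h]
  have hz : z ∉ (I : Set Q) := fun h => by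
    rcases (hI z).1 h with h | h | h
    exacts [h4 h, h6 h, lt_irrefl _ h]
  have hXc : (X : Set Q).ncard = (I : Set Q).ncard + 1 := by rw [hX, Set.ncard_insert_of_notMem hx]
  have hYc : (Y : Set Q).ncard = (I : Set Q).ncard + 1 := by rw [hY, Set.ncard_insert_of_notMem hy]
  have hZc : (Z : Set Q).ncard = (I : Set Q).ncard + 1 := by rw [hZ, Set.ncard_insert_of_notMem hz]
  refine (h _ ?_).not_gt (two_lt_ncard_of_three hXc hYc hZc ?_ ?_ ?_)
  · rw [← hXc]; exact Set.ncard_le_card _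
  · intro h
    have : x ∈ (Y : Set Q) := h ▸ hX ▸ Set.mem_insert _ _
    rw [hY] at this
    exact this.elim hxy hx
  · intro h
    have : x ∈ (Z : Set Q) := h ▸ hX ▸ Set.mem_insert _ _
    rw [hZ] at this
    exact this.elim hxz hx
  · intro h
    have : y ∈ (Z : Set Q) := h ▸ hY ▸ Set.mem_insert _ _
    rw [hZ] at this
    exact this.elim hyz hy

/-- From a < b and c < d one gets an ideal `I` to which {a, b}, {c, d} or {a, c} can be added,
giving three ideals of the same size. -/
theorem twoPlusTwoFree_of_ncard_le_two [Finite Q]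
    (h : ∀ i ≤ Nat.card Q, {I : LowerSet Q | (I : Set Q).ncard = i}.ncard ≤ 2) :
    TwoPlusTwoFree Q := by
  refine ⟨fun f => ?_⟩
  have hlt1 : f (.inl 0) < f (.inl 1) := f.lt_iff_lt.2 (by simp)
  have hlt2 : f (.inr 0) < f (.inr 1) := f.lt_iff_lt.2 (by simp)
  have e1 : ¬ f (.inl 0) ≤ f (.inr 1) := by simp
  have e2 : ¬ f (.inr 0) ≤ f (.inl 1) := by simp
  generalize f (.inl 0) = a at *
  generalize f (.inl 1) = b' at *
  generalize f (.inr 0) = c at *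
  generalize f (.inr 1) = d' at *
  have : Fintype Q := Fintype.ofFinite Q
  -- Lowering the tops until they cover the bottoms keeps the incomparabilities. The covering
  -- relations are what makes `I` below a lower set after `a` and `c` are left out.
  obtain ⟨b, hab, hbb⟩ := exists_covBy_le_of_lt hlt1
  obtain ⟨d, hcd, hdd⟩ := exists_covBy_le_of_lt hlt2
  have had : ¬ a ≤ d := fun h => e1 (h.trans hdd)
  have hcb : ¬ c ≤ b := fun h => e2 (h.trans hbb)
  have hac : ¬ a ≤ c := fun h => had (h.trans hcd.le)
  have hca : ¬ c ≤ a := fun h => hcb (h.trans hab.le)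
  have hbd : ¬ b ≤ d := fun h => had (hab.le.trans h)
  have hdb : ¬ d ≤ b := fun h => hcb (hcd.le.trans h)
  let I : LowerSet Q := ⟨{x | x < b ∧ x ≠ a ∨ x < d ∧ x ≠ c}, fun x y hyx hx => by
    rcases hx with ⟨h1, h2⟩ | ⟨h1, h2⟩
    · refine Or.inl ⟨hyx.trans_lt h1, ?_⟩
      rintro rfl
      exact hab.2 (lt_of_le_of_ne hyx h2.symm) h1
    · refine Or.inr ⟨hyx.trans_lt h1, ?_⟩
      rintro rfl
      exact hcd.2 (lt_of_le_of_ne hyx h2.symm) h1⟩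
  have hI : ∀ x, x ∈ (I : Set Q) ↔ x < b ∧ x ≠ a ∨ x < d ∧ x ≠ c := fun _ => Iff.rfl
  have ha : a ∉ (I : Set Q) := fun h => by
    rcases (hI a).1 h with h | h
    exacts [h.2 rfl, had h.1.le]
  have hc : c ∉ (I : Set Q) := fun h => by
    rcases (hI c).1 h with h | h
    exacts [hcb h.1.le, h.2 rfl]
  have hb : b ∉ (I : Set Q) := fun h => by
    rcases (hI b).1 h with h | h
    exacts [lt_irrefl _ h.1, hbd h.1.le]
  have hd : d ∉ (I : Set Q) := fun h => by
    rcases (hI d).1 h with h | h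
    exacts [hdb h.1.le, lt_irrefl _ h.1]
  obtain ⟨A, hA⟩ := I.exists_insert (x := a) fun x hx => Or.inl ⟨hx.trans hab.lt, hx.ne⟩
  obtain ⟨C, hC⟩ := I.exists_insert (x := c) fun x hx => Or.inr ⟨hx.trans hcd.lt, hx.ne⟩
  obtain ⟨AB, hAB⟩ := A.exists_insert (x := b) fun x hx => by
    rw [← SetLike.mem_coe, hA]
    by_cases hxa : x = a
    exacts [Or.inl hxa, Or.inr (Or.inl ⟨hx, hxa⟩)]
  obtain ⟨CD, hCD⟩ := C.exists_insert (x := d) fun x hx => by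
    rw [← SetLike.mem_coe, hC]
    by_cases hxc : x = c
    exacts [Or.inl hxc, Or.inr (Or.inr ⟨hx, hxc⟩)]
  obtain ⟨AC, hAC⟩ := A.exists_insert (x := c) fun x hx => by
    rw [← SetLike.mem_coe, hA]
    exact Or.inr (Or.inr ⟨hx.trans hcd.lt, hx.ne⟩)
  rw [hA] at hAB hAC
  rw [hC] at hCD
  have nab : b ≠ a := hab.lt.ne'
  have ncd : d ≠ c := hcd.lt.ne'
  have nac : c ≠ a := fun h => hca h.le
  have nad : a ≠ d := fun h => had h.le
  have ncb : c ≠ b := fun h => hcb h.le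
  have nbd : b ≠ d := fun h => hbd h.le
  have k1 : (AB : Set Q).ncard = (I : Set Q).ncard + 2 := by
    rw [hAB, Set.ncard_insert_of_notMem (by simp [nab] at hb ⊢; exact hb),
      Set.ncard_insert_of_notMem ha]
  have k2 : (CD : Set Q).ncard = (I : Set Q).ncard + 2 := by
    rw [hCD, Set.ncard_insert_of_notMem (by simp [ncd] at hd ⊢; exact hd),
      Set.ncard_insert_of_notMem hc]
  have k3 : (AC : Set Q).ncard = (I : Set Q).ncard + 2 := by
    rw [hAC, Set.ncard_insert_of_notMem (by simp [nac] at hc ⊢; exact hc),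
      Set.ncard_insert_of_notMem ha]
  refine (h _ ?_).not_gt (two_lt_ncard_of_three k1 k2 k3 ?_ ?_ ?_)
  · rw [← k1]; exact Set.ncard_le_card _
  · intro h
    have : a ∈ (CD : Set Q) := by rw [← h, hAB]; simp
    rw [hCD] at this
    rcases this with h | h | h
    exacts [nad h, nac h.symm, ha h]
  · intro h
    have : b ∈ (AC : Set Q) := by rw [← h, hAB]; simp
    rw [hAC] at this
    rcases this with h | h | h
    exacts [ncb h.symm, nab h, hb h]
  · intro h
    have : a ∈ (CD : Set Q) := by rw [h, hAC]; simp
    rw [hCD] at this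
    rcases this with h | h | h
    exacts [nad h, nac h.symm, ha h]

end forbidden

/-! ### Canonical codes and the existence of encodings -/

/-- The canonical omission sequences of length `n`, extended by `p k = k` for `k ≥ n`. The previous
value is repeated only if the two previous elements both omit a smaller one; otherwise exchanging
these two elements, or the choice `p (k + 2) = k + 1`, gives the same poset. -/
def codes (n : ℕ) : Set (ℕ → ℕ) :=
  {p | p 0 = 0 ∧ (p 1 = 1 ∨ p 1 = 0) ∧
    (∀ k, p (k + 2) = k + 2 ∨ p (k + 2) = k + 1 ∨
      p (k + 2) = p (k + 1) ∧ p (k + 1) < k + 1 ∧ p k < k) ∧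
    ∀ k, n ≤ k → p k = k}

theorem omissionSeq_of_mem_codes {n : ℕ} {p : ℕ → ℕ} (hp : p ∈ codes n) : OmissionSeq p := by
  obtain ⟨h0, h1, h2, -⟩ := hp
  refine ⟨h0, fun k => ?_⟩
  rcases k with _ | k
  · rcases h1 with h | h
    · exact Or.inl h
    · exact Or.inr (Or.inl h)
  · rcases h2 k with h | h | h
    · exact Or.inl h
    · exact Or.inr (Or.inl h)
    · exact Or.inr (Or.inr h.1)

theorem codes_mono {m n : ℕ} (h : m ≤ n) : codes m ⊆ codes n :=
  fun _ hp => ⟨hp.1, hp.2.1, hp.2.2.1, fun k hk => hp.2.2.2 k (h.trans hk)⟩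

/-- This appends an element numbered `n` that omits `q`. For `q = n` nothing is omitted and `p`
itself does not change, because of its default value at `n`. -/
theorem update_mem_codes {n q : ℕ} {p : ℕ → ℕ} (hp : p ∈ codes n)
    (hq : q = n ∨ q + 1 = n ∨
      ∃ k, n = k + 2 ∧ q = p (k + 1) ∧ p (k + 1) < k + 1 ∧ p k < k) :
    Function.update p n q ∈ codes (n + 1) := by
  obtain ⟨h0, h1, h2, h3⟩ := hp
  refine ⟨?_, ?_, fun k => ?_, fun k hk => ?_⟩
  · rcases hq with h | h | ⟨k, h, -⟩ <;> simp only [Function.update_apply] <;> split_ifs <;> omega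
  · rcases hq with h | h | ⟨k, h, -⟩ <;> simp only [Function.update_apply] <;> split_ifs <;> omega
  · have := h2 k
    have h4 := h3 (k + 2)
    simp only [Function.update_apply]
    rcases hq with h | h | ⟨l, rfl, h, h'⟩
    · split_ifs <;> omega
    · split_ifs <;> omega
    · by_cases hkl : k = l
      · subst hkl
        split_ifs <;> omega
      · split_ifs <;> omega
  · rw [Function.update_of_ne (by omega)]
    exact h3 k (by omega)

/-- `e` encodes the induced subposet on the finite set `A`. -/
structure EncodesOn {Q : Type*} [PartialOrder Q] (A : Finset Q) (e : Q → ℕ) (p : ℕ → ℕ) :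
    Prop where
  injOn : Set.InjOn e A
  lt : ∀ x ∈ A, e x < A.card
  lt_iff : ∀ x ∈ A, ∀ y ∈ A, x < y ↔ e x < e y ∧ e x ≠ p (e y)

namespace EncodesOn

variable {Q : Type*} [PartialOrder Q] {A : Finset Q} {e : Q → ℕ} {p : ℕ → ℕ}

theorem surj (h : EncodesOn A e p) {k : ℕ} (hk : k < A.card) : ∃ x ∈ A, e x = k := by
  have : A.image e = Finset.range A.card :=
    Finset.eq_of_subset_of_card_le (fun k hk => by
      obtain ⟨x, hx, rfl⟩ := Finset.mem_image.1 hk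
      exact Finset.mem_range.2 (h.lt x hx))
      (by rw [Finset.card_range, Finset.card_image_of_injOn h.injOn])
  exact Finset.mem_image.1 (this ▸ Finset.mem_range.2 hk)

theorem insert [DecidableEq Q] (h : EncodesOn A e p) {z : Q} (hz : z ∉ A) {q : ℕ}
    (hmax : ∀ x ∈ A, ¬ z < x) (hq : ∀ x ∈ A, x < z ↔ e x ≠ q) :
    EncodesOn (insert z A) (Function.update e z A.card) (Function.update p A.card q) := by
  have hne : ∀ x ∈ A, x ≠ z := fun x hx => by rintro rfl; exact hz hx
  have he : ∀ x ∈ A, Function.update e z A.card x = e x := fun x hx =>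
    Function.update_of_ne (hne x hx) _ _
  refine ⟨fun x hx y hy hxy => ?_, fun x hx => ?_, fun x hx y hy => ?_⟩
  · rcases Finset.mem_insert.1 hx with rfl | hx' <;> rcases Finset.mem_insert.1 hy with rfl | hy
    · rfl
    · rw [he y hy, Function.update_self] at hxy
      exact absurd hxy (h.lt y hy).ne'
    · rw [he x hx', Function.update_self] at hxy
      exact absurd hxy (h.lt x hx').ne
    · rw [he x hx', he y hy] at hxy
      exact h.injOn hx' hy hxy
  · rw [Finset.card_insert_of_notMem hz]
    rcases Finset.mem_insert.1 hx with rfl | hx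
    · simp
    · rw [he x hx]
      exact (h.lt x hx).trans (Nat.lt_succ_self _)
  · rcases Finset.mem_insert.1 hx with rfl | hx' <;> rcases Finset.mem_insert.1 hy with rfl | hy
    · simp
    · have := h.lt y hy
      rw [he y hy, Function.update_self]
      exact iff_of_false (hmax y hy) (by omega)
    · have := h.lt x hx'
      rw [he x hx', Function.update_self, Function.update_self, hq x hx']
      exact ⟨fun h => ⟨this, h⟩, And.right⟩
    · rw [he x hx', he y hy, h.lt_iff x hx' y hy, Function.update_of_ne (h.lt y hy).ne]

/-- The two last elements can be exchanged if they form an antichain above all the others. -/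
theorem swap (h : EncodesOn A e p) (hp : OmissionSeq p) {k : ℕ} (hk : A.card = k + 2)
    (h1 : p (k + 1) = k) (h2 : p k = k) :
    EncodesOn A (fun x => Equiv.swap k (k + 1) (e x)) p := by
  have key : ∀ i < k + 2, ∀ j < k + 2, (i < j ∧ i ≠ p j ↔
      Equiv.swap k (k + 1) i < Equiv.swap k (k + 1) j ∧
        Equiv.swap k (k + 1) i ≠ p (Equiv.swap k (k + 1) j)) := by
    intro i hi j hj
    have := hp.le_self j
    simp only [Equiv.swap_apply_def]
    by_cases j1 : j = k
    · subst j1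
      split_ifs <;> omega
    · by_cases j2 : j = k + 1
      · subst j2
        split_ifs <;> omega
      · split_ifs <;> omega
  refine ⟨fun x hx y hy hxy => h.injOn hx hy ((Equiv.swap k (k + 1)).injective hxy),
    fun x hx => ?_, fun x hx y hy => ?_⟩
  · have := h.lt x hx
    simp only [Equiv.swap_apply_def]
    split_ifs <;> omega
  · rw [h.lt_iff x hx y hy]
    exact key _ (hk ▸ h.lt x hx) _ (hk ▸ h.lt y hy)

end EncodesOn

theorem exists_encodesOn {Q : Type*} [PartialOrder Q] (h22 : TwoPlusTwoFree Q)
    (h111 : OnePlusOnePlusOneFree Q) (A : Finset Q) :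
    ∃ p ∈ codes A.card, ∃ e, EncodesOn A e p := by
  classical
  rw [twoPlusTwoFree_iff] at h22
  rw [onePlusOnePlusOneFree_iff] at h111
  generalize hn : A.card = n
  induction n generalizing A with
  | zero =>
    rw [Finset.card_eq_zero] at hn
    subst hn
    exact ⟨id, ⟨rfl, Or.inl rfl, fun k => Or.inl rfl, fun _ _ => rfl⟩, fun _ => 0,
      by simp, by simp, by simp⟩
  | succ n ih =>
    -- By nestedness, the largest strict down-set contains all the others; `z` will receive the last
    -- number.
    obtain ⟨z, hzA, hz⟩ := A.exists_max_image (fun z => (A.filter (· < z)).card)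
      (Finset.card_pos.1 (by omega))
    have hdown : ∀ m ∈ A, ∀ a ∈ A, a < m → a < z := by
      intro m hm a ha ham
      rcases h22 m z with h | h
      · exact h a ham
      · have hsub : A.filter (· < z) ⊆ A.filter (· < m) :=
          Finset.monotone_filter_right A fun a _ => h a
        have := Finset.eq_of_subset_of_card_le hsub (hz m hm)
        have h4 : a ∈ A.filter (· < m) := Finset.mem_filter.2 ⟨ha, ham⟩
        rw [← this] at h4
        exact (Finset.mem_filter.1 h4).2
    have hzmax : ∀ x ∈ A, ¬ z < x := fun x hx hlt => lt_irrefl _ (hdown x hx z hzA hlt)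
    obtain ⟨B, hzB, rfl⟩ : ∃ B, z ∉ B ∧ A = insert z B :=
      ⟨A.erase z, Finset.notMem_erase _ _, (Finset.insert_erase hzA).symm⟩
    have hB : B.card = n := by rw [Finset.card_insert_of_notMem hzB] at hn; omega
    have hsub : ∀ x ∈ B, x ∈ insert z B := fun x hx => Finset.mem_insert_of_mem hx
    obtain ⟨p, hp, e, he⟩ := ih B hB
    have hp' := omissionSeq_of_mem_codes hp
    by_cases htop : ∀ x ∈ B, x < z
    · refine ⟨_, update_mem_codes (q := n) hp (Or.inl rfl), Function.update e z n, ?_⟩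
      have := he.insert hzB (q := n) (fun x hx => hzmax x (hsub x hx)) fun x hx =>
        iff_of_true (htop x hx) (hB ▸ (he.lt x hx).ne)
      rwa [hB] at this
    · push Not at htop
      obtain ⟨y, hyB, hyz⟩ := htop
      have huniq : ∀ x ∈ B, ¬ x < z → x = y := fun x hx hxz => by
        by_contra hxy
        exact h111 x y z hxy (fun h => hzB (h ▸ hx)) (fun h => hzB (h ▸ hyB))
          (fun h => hxz (hdown y (hsub y hyB) x (hsub x hx) h))
          (fun h => hyz (hdown x (hsub x hx) y (hsub y hyB) h)) hxz (hzmax x (hsub x hx))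
          hyz (hzmax y (hsub y hyB))
      have hlt : ∀ f : Q → ℕ, Set.InjOn f B → ∀ x ∈ B, x < z ↔ f x ≠ f y :=
        fun f hf x hx => ⟨fun h heq => hyz (hf hx hyB heq ▸ h), fun h => by
          by_contra hxz
          exact h (huniq x hx hxz ▸ rfl)⟩
      -- Otherwise `y` would lie below the element numbered `n - 1`, hence below `z` by `hdown`.
      have hymax : e y + 1 = n ∨ e y = p (n - 1) := by
        by_contra! hcon
        have h1 := he.lt y hyB
        obtain ⟨x, hx, hxe⟩ := he.surj (k := n - 1) (by omega)
        exact hyz (hdown x (hsub x hx) y (hsub y hyB)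
          ((he.lt_iff y hyB x hx).2 ⟨by omega, by rw [hxe]; exact hcon.2⟩))
      have finish : ∀ f, EncodesOn B f p → (f y = n ∨ f y + 1 = n ∨
          ∃ k, n = k + 2 ∧ f y = p (k + 1) ∧ p (k + 1) < k + 1 ∧ p k < k) →
          ∃ p ∈ codes (n + 1), ∃ e, EncodesOn (insert z B) e p := fun f hf hq => by
        refine ⟨_, update_mem_codes hp hq, Function.update f z n, ?_⟩
        have := hf.insert hzB (q := f y) (fun x hx => hzmax x (hsub x hx)) (hlt f hf.injOn)
        rwa [hB] at this
      rcases hymax with h | h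
      · exact finish e he (Or.inr (Or.inl h))
      · have h1 := he.lt y hyB
        rw [hB] at h1
        obtain ⟨k, rfl | rfl⟩ : ∃ k, n = 1 ∨ n = k + 2 := ⟨n - 2, by omega⟩
        · exact finish e he (by omega)
        · have h2 := hp'.le_self (k + 1)
          have h3 := hp'.le_self k
          rcases h2.eq_or_lt with h4 | h4
          · exact finish e he (Or.inr (Or.inl (by simp at h; omega)))
          -- If `k` omits nothing and `k + 1` omits `k`, these two elements are interchangeable, and
          -- a repeated omission of `k` is not canonical. Exchanging them makes `z` omit its
          -- immediate predecessor instead.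
          · rcases h3.eq_or_lt with h5 | h5
            · have h6 : p (k + 1) = k := by
                rcases hp'.succ k with h6 | h6 | h6 <;> omega
              refine finish _ (he.swap hp' hB h6 h5) (Or.inr (Or.inl ?_))
              have : e y = k := by simp at h; omega
              rw [this, Equiv.swap_apply_left]
            · exact finish e he (Or.inr (Or.inr ⟨k, rfl, h, h4, h5⟩))

theorem exists_encodes {Q : Type*} [PartialOrder Q] [Finite Q] (h22 : TwoPlusTwoFree Q)
    (h111 : OnePlusOnePlusOneFree Q) :
    ∃ p ∈ codes (Nat.card Q), ∃ e : Q → ℕ, Encodes e (Nat.card Q) p := by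
  have := Fintype.ofFinite Q
  obtain ⟨p, hp, e, he⟩ := exists_encodesOn h22 h111 Finset.univ
  rw [Finset.card_univ, ← Nat.card_eq_fintype_card] at hp
  refine ⟨p, hp, e, fun x y h => he.injOn (by simp) (by simp) h, fun x => ?_, fun k hk => ?_,
    fun x y => he.lt_iff x (by simp) y (by simp)⟩
  · simpa using he.lt x
  · obtain ⟨x, -, hx⟩ := he.surj (k := k) (by simpa using hk)
    exact ⟨x, hx⟩

/-! ### Descent sets and the flag vectors of encoded posets -/

/-- The sets of ranks that contribute to the flag `h`-vector of the poset with omission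
sequence `p`. -/
def IsDescentSet (p : ℕ → ℕ) (T : Finset ℕ) : Prop :=
  ∀ t ∈ T, p t < t ∧ ∀ s ∈ T, s < t → s < p t

/-- The chains with rank set `S` use the punctured ideals exactly at such a set `V` of ranks. -/
def IsPuncturedSet (p : ℕ → ℕ) (S V : Finset ℕ) : Prop :=
  ∀ t ∈ V, p t < t ∧ ∀ s ∈ S, s < t → (p t < s → s ∈ V) ∧ (p t = s → s ∉ V)

theorem IsDescentSet.isSparse {p : ℕ → ℕ} {T : Finset ℕ} (h : IsDescentSet p T) : IsSparse T := by
  rintro i ⟨h1, h2⟩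
  have h3 := (h _ h2).2 _ h1 (Nat.lt_succ_self i)
  have h4 := (h _ h2).1
  omega

-- In a punctured set `V`, call `s` blocked if `p t < s < t` for some `t ∈ V`. Discarding the
-- blocked ranks gives a descent set `T`; conversely, `V` is recovered by adding to `T` all ranks in
-- `S` that lie strictly between `p t` and `t` for some `t ∈ T`.
open Classical in
theorem card_isPuncturedSet {p : ℕ → ℕ} (hp : OmissionSeq p) (S : Finset ℕ) :
    (S.powerset.filter (IsPuncturedSet p S)).card = (S.powerset.filter (IsDescentSet p)).card := by
  have hmem : ∀ (V : Finset ℕ) (s : ℕ),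
      s ∈ V.filter (fun s => ∀ t ∈ V, s < t → s ≤ p t) ↔ s ∈ V ∧ ∀ t ∈ V, s < t → s ≤ p t :=
    fun _ _ => Finset.mem_filter
  have hmem' : ∀ (T : Finset ℕ) (s : ℕ),
      s ∈ T ∪ S.filter (fun s => ∃ t ∈ T, p t < s ∧ s < t) ↔
        s ∈ T ∨ s ∈ S ∧ ∃ t ∈ T, p t < s ∧ s < t :=
    fun _ _ => by rw [Finset.mem_union, Finset.mem_filter]
  -- The largest rank `m` blocking `t` is itself unblocked: a rank blocking `m` would have the same
  -- value of `p` and so would block `t` too.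
  have hunblocked : ∀ V ∈ S.powerset.filter (IsPuncturedSet p S), ∀ t ∈ V,
      t ∈ V.filter (fun s => ∀ t ∈ V, s < t → s ≤ p t) ∨
        ∃ t' ∈ V.filter (fun s => ∀ t ∈ V, s < t → s ≤ p t), t < t' ∧ p t' < t := by
    intro V hV t ht
    by_cases hb : ∃ t' ∈ V, t < t' ∧ p t' < t
    · right
      have hne : (V.filter fun t' => t < t' ∧ p t' < t).Nonempty := by
        obtain ⟨t', h1, h2⟩ := hb
        exact ⟨t', Finset.mem_filter.2 ⟨h1, h2⟩⟩
      obtain ⟨m, hm, hmax⟩ := Finset.exists_max_image _ id hne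
      obtain ⟨hmV, htm, hpm⟩ := Finset.mem_filter.1 hm
      refine ⟨m, (hmem _ _).2 ⟨hmV, fun r hr hmr => ?_⟩, htm, hpm⟩
      by_contra! hlt
      have := hp.eq_of_lt hlt hmr.le
      have := hmax r (Finset.mem_filter.2 ⟨hr, by omega, by omega⟩)
      simp only [id] at this
      omega
    · push Not at hb
      exact Or.inl ((hmem _ _).2 ⟨ht, hb⟩)
  refine Finset.card_bij' (fun V _ => V.filter fun s => ∀ t ∈ V, s < t → s ≤ p t)
    (fun T _ => T ∪ S.filter fun s => ∃ t ∈ T, p t < s ∧ s < t) ?_ ?_ ?_ ?_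
  · intro V hV
    obtain ⟨hVS, hV⟩ := Finset.mem_filter.1 hV
    rw [Finset.mem_powerset] at hVS
    refine Finset.mem_filter.2 ⟨Finset.mem_powerset.2 ((Finset.filter_subset _ _).trans hVS),
      fun t ht => ?_⟩
    rw [hmem] at ht
    refine ⟨(hV t ht.1).1, fun s hs hst => ?_⟩
    rw [hmem] at hs
    refine lt_of_le_of_ne (hs.2 t ht.1 hst) fun heq => ?_
    exact ((hV t ht.1).2 s (hVS hs.1) hst).2 heq.symm hs.1
  · intro T hT
    obtain ⟨hTS, hT⟩ := Finset.mem_filter.1 hT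
    rw [Finset.mem_powerset] at hTS
    refine Finset.mem_filter.2 ⟨Finset.mem_powerset.2
      (Finset.union_subset hTS (Finset.filter_subset _ _)), fun t ht => ?_⟩
    rw [hmem'] at ht
    have hdesc : ∀ {a b : ℕ}, a ∈ T → b ∈ T → a < b → a < p b := fun ha hb => (hT _ hb).2 _ ha
    rcases ht with ht | ⟨htS, r, hr, hpr, htr⟩
    · refine ⟨(hT t ht).1, fun s hs hst => ⟨fun h => (hmem' _ _).2 (Or.inr ⟨hs, t, ht, h, hst⟩),
        fun h hsV => ?_⟩⟩
      rcases (hmem' _ _).1 hsV with h1 | ⟨-, r, hr, hpr, hsr⟩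
      · have := hdesc h1 ht hst
        omega
      · rcases lt_trichotomy t r with h2 | rfl | h2
        · have := hdesc ht hr h2; omega
        · omega
        · have := hdesc hr ht h2; omega
    · have heq := hp.eq_of_lt hpr htr.le
      refine ⟨by omega, fun s hs hst => ⟨fun h => (hmem' _ _).2 (Or.inr ⟨hs, r, hr, by omega,
        by omega⟩), fun h hsV => ?_⟩⟩
      rcases (hmem' _ _).1 hsV with h1 | ⟨-, r', hr', hpr', hsr'⟩
      · have := hdesc h1 hr (by omega)
        omega
      · rcases lt_trichotomy r r' with h2 | rfl | h2
        · have := hdesc hr hr' h2; omega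
        · omega
        · have := hdesc hr' hr h2; omega
  · intro V hV
    have hub := hunblocked V hV
    obtain ⟨hVS, hV⟩ := Finset.mem_filter.1 hV
    rw [Finset.mem_powerset] at hVS
    ext s
    rw [hmem']
    constructor
    · rintro (h | ⟨hs, t, ht, h1, h2⟩)
      · exact ((hmem _ _).1 h).1
      · exact ((hV t ((hmem _ _).1 ht).1).2 s hs h2).1 h1
    · intro hs
      rcases hub s hs with h | ⟨t, ht, h1, h2⟩
      · exact Or.inl h
      · exact Or.inr ⟨hVS hs, t, ht, h2, h1⟩
  · intro T hT
    obtain ⟨hTS, hT⟩ := Finset.mem_filter.1 hT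
    ext s
    rw [hmem, hmem']
    constructor
    · rintro ⟨h | ⟨hs, t, ht, h1, h2⟩, hb⟩
      · exact h
      · have := hb t ((hmem' _ _).2 (Or.inl ht)) h2
        omega
    · intro hs
      refine ⟨Or.inl hs, fun t ht hst => ?_⟩
      rcases (hmem' _ _).1 ht with h | ⟨-, r, hr, h1, h2⟩
      · exact ((hT t h).2 s hs hst).le
      · have := (hT r hr).2 s hs (hst.trans h2)
        rw [hp.eq_of_lt h1 h2.le]
        exact this.le

namespace Encodes

variable {Q : Type*} [PartialOrder Q] {e : Q → ℕ} {n : ℕ} {p : ℕ → ℕ}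

open Classical in
/-- The ideal of rank `s` that is punctured if `s ∈ V`. -/
def idealAt (h : Encodes e n p) (hp : OmissionSeq p) (V : Finset ℕ) (s : ℕ) : LowerSet Q :=
  if s ∈ V then h.punctured hp s else h.initial s

theorem posetRank_idealAt (h : Encodes e n p) (hp : OmissionSeq p) (V : Finset ℕ) {s : ℕ}
    (hs : s < n) : posetRank (h.idealAt hp V s) = s := by
  have := h.finite
  rw [posetRank_lowerSet, idealAt]
  split_ifs
  · exact h.ncard_punctured hp hs
  · exact h.ncard_initial hs.le

-- A chain has exactly one ideal at each rank in `S`, so it is determined by the set of ranks where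
-- that ideal is punctured. The inclusion criteria for initial and punctured ideals translate the
-- chain condition into `IsPuncturedSet`.
open Classical in
theorem flagFVector_eq (h : Encodes e n p) (hp : OmissionSeq p) {S : Finset ℕ}
    (hS : ∀ s ∈ S, s < n) :
    flagFVector (LowerSet Q) S = (S.powerset.filter (IsDescentSet p)).card := by
  have := h.finite
  rw [← card_isPuncturedSet hp, flagFVector, ← Set.ncard_coe_finset]
  have hinj : Set.InjOn (fun V : Finset ℕ => h.idealAt hp V '' (S : Set ℕ))
      (S.powerset.filter (IsPuncturedSet p S) : Finset (Finset ℕ)) := by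
    have key : ∀ V ∈ S.powerset.filter (IsPuncturedSet p S),
        ∀ V' ∈ S.powerset.filter (IsPuncturedSet p S),
        h.idealAt hp V '' (S : Set ℕ) = h.idealAt hp V' '' (S : Set ℕ) → V ⊆ V' := by
      intro V hV V' hV' heq s hs
      obtain ⟨hVS, hV⟩ := Finset.mem_filter.1 hV
      have hsS : s ∈ S := Finset.mem_powerset.1 hVS hs
      have h1 : h.idealAt hp V s ∈ h.idealAt hp V' '' (S : Set ℕ) := heq ▸ ⟨s, hsS, rfl⟩
      obtain ⟨s', hs', h2⟩ := h1
      have h3 := congrArg posetRank h2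
      rw [h.posetRank_idealAt hp V' (hS s' hs'), h.posetRank_idealAt hp V (hS s hsS)] at h3
      subst h3
      by_contra hn
      rw [idealAt, if_neg hn, idealAt, if_pos hs] at h2
      exact h.punctured_ne_initial hp (hS _ hsS) (hV _ hs).1 h2.symm
    exact fun V hV V' hV' heq =>
      (key V hV V' hV' heq).antisymm (key V' hV' V hV heq.symm)
  rw [← hinj.ncard_image]
  congr 1
  ext C
  simp only [Set.mem_ofPred_eq, Set.mem_image]
  constructor
  · rintro ⟨hC, hCS⟩
    have hrank : ∀ I ∈ C, posetRank I ∈ S := fun I hI => by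
      have : posetRank I ∈ posetRank '' C := ⟨I, hI, rfl⟩
      rwa [hCS] at this
    have hle : ∀ I ∈ C, ∀ J ∈ C, posetRank I ≤ posetRank J → I ≤ J := fun I hI J hJ hIJ => by
      rcases hC.total hI hJ with h1 | h1
      · exact h1
      · rw [posetRank_lowerSet, posetRank_lowerSet] at hIJ
        exact (LowerSet.eq_of_le_of_ncard_le h1 hIJ).ge
    -- The condition `p s < s` excludes the ranks at which the two kinds of ideals coincide; without
    -- it `V` might fail to be a punctured set.
    set V := S.filter fun s => p s < s ∧ h.punctured hp s ∈ C with hVdef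
    have hmem : ∀ s ∈ S, h.idealAt hp V s ∈ C := by
      intro s hs
      by_cases hsV : s ∈ V
      · rw [idealAt, if_pos hsV]
        exact (Finset.mem_filter.1 hsV).2.2
      · rw [idealAt, if_neg hsV]
        obtain ⟨I, hI, hIs⟩ : s ∈ posetRank '' C := hCS ▸ hs
        rw [posetRank_lowerSet] at hIs
        rcases h.eq_initial_or_punctured hp I hIs with h1 | ⟨-, h1⟩
        · exact h1 ▸ hI
        · rcases (hp.le_self s).lt_or_eq with h2 | h2
          · exact absurd (Finset.mem_filter.2 ⟨hs, h2, h1 ▸ hI⟩) hsV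
          · rw [← h.punctured_eq_initial hp h2]
            exact h1 ▸ hI
    refine ⟨V, Finset.mem_filter.2 ⟨Finset.mem_powerset.2 (Finset.filter_subset _ _),
      fun t ht => ?_⟩, ?_⟩
    · obtain ⟨htS, hpt, -⟩ := Finset.mem_filter.1 ht
      refine ⟨hpt, fun s hs hst => ?_⟩
      have h1 := hle _ (hmem s hs) _ (hmem t htS) (by
        rw [h.posetRank_idealAt hp V (hS s hs), h.posetRank_idealAt hp V (hS t htS)]
        exact hst.le)
      rw [idealAt, idealAt, if_pos ht] at h1
      split_ifs at h1 with hsV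
      · rw [h.punctured_le_punctured_iff hp hst (hS t htS)] at h1
        have := (Finset.mem_filter.1 hsV).2.1
        exact ⟨fun _ => hsV, fun heq => by omega⟩
      · rw [h.initial_le_punctured_iff hp hst (hS t htS)] at h1
        exact ⟨fun hlt => absurd hlt h1.not_gt, fun _ => hsV⟩
    · ext I
      constructor
      · rintro ⟨s, hs, rfl⟩
        exact hmem s hs
      · intro hI
        have h1 := h.posetRank_idealAt hp V (hS _ (hrank I hI))
        exact ⟨posetRank I, hrank I hI, le_antisymm
          (hle _ (hmem _ (hrank I hI)) _ hI h1.le) (hle _ hI _ (hmem _ (hrank I hI)) h1.ge)⟩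
  · rintro ⟨V, hV, rfl⟩
    obtain ⟨hVS, hV⟩ := Finset.mem_filter.1 hV
    have hle : ∀ s ∈ S, ∀ t ∈ S, s < t → h.idealAt hp V s ≤ h.idealAt hp V t := by
      intro s hs t ht hst
      rw [idealAt, idealAt]
      split_ifs with hsV htV htV
      · rw [h.punctured_le_punctured_iff hp hst (hS t ht)]
        obtain ⟨-, h1⟩ := hV t htV
        have h2 := (h1 s hs hst).2
        by_cases h3 : p t < s
        · exact Or.inr (hp.eq_of_lt h3 hst.le)
        · have : p t ≠ s := fun h4 => h2 h4 hsV
          omega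
      · exact h.punctured_le_initial hp hst
      · rw [h.initial_le_punctured_iff hp hst (hS t ht)]
        by_contra! h3
        exact hsV (((hV t htV).2 s hs hst).1 h3)
      · exact h.initial_le_initial hst.le
    constructor
    · rintro _ ⟨s, hs, rfl⟩ _ ⟨t, ht, rfl⟩ hne
      rcases lt_trichotomy s t with h1 | rfl | h1
      · exact Or.inl (hle s hs t ht h1)
      · exact absurd rfl hne
      · exact Or.inr (hle t ht s hs h1)
    · rw [Set.image_image]
      ext k
      constructor
      · rintro ⟨s, hs, rfl⟩
        dsimp only
        rwa [h.posetRank_idealAt hp V (hS s hs)]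
      · exact fun hk => ⟨k, hk, h.posetRank_idealAt hp V (hS k hk)⟩

open Classical in
theorem flagHVector_eq (h : Encodes e n p) (hp : OmissionSeq p) {S : Finset ℕ}
    (hS : ∀ s ∈ S, s < n) :
    flagHVector (LowerSet Q) S = if IsDescentSet p S then 1 else 0 :=
  flagHVector_eq_of_flagFVector_eq (γ := fun T => if IsDescentSet p T then 1 else 0)
    fun T hT => by
      rw [h.flagFVector_eq hp fun s hs => hS s (hT hs), Finset.sum_boole]

end Encodes

/-! ### The equivalence of the conditions, and sparseness -/

theorem posetRank_top_lowerSet {Q : Type*} [PartialOrder Q] [Finite Q] :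
    posetRank (⊤ : LowerSet Q) = Nat.card Q := by
  rw [posetRank_lowerSet, LowerSet.coe_top, Set.ncard_univ]

/-- For 0 < i < n the value β({i}) is one less than the number of ideals of rank i, and it is at
most 1. Ranks 0 and n contain only the bottom and the top. -/
theorem IdealsMultiplicityFree.ncard_le_two {Q : Type*} [PartialOrder Q] [Finite Q]
    (h : IdealsMultiplicityFree Q) {i : ℕ} (hi : i ≤ Nat.card Q) :
    {I : LowerSet Q | posetRank I = i}.ncard ≤ 2 := by
  have hinj : ∀ I J : LowerSet Q, I ≤ J → posetRank I = posetRank J → I = J :=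
    fun I J hIJ heq => by
      rw [posetRank_lowerSet, posetRank_lowerSet] at heq
      exact LowerSet.eq_of_le_of_ncard_le hIJ heq.ge
  rcases Nat.eq_zero_or_pos i with rfl | hpos
  · refine ((Set.ncard_le_one_iff (Set.toFinite _)).2 fun {I J} hI hJ => ?_).trans one_le_two
    have h0 : ∀ K : LowerSet Q, posetRank K = 0 → ⊥ = K := fun K hK =>
      hinj _ _ bot_le (hK ▸ by simp [posetRank_lowerSet])
    exact (h0 I hI).symm.trans (h0 J hJ)
  rcases hi.lt_or_eq with hlt | rfl
  · have := h {i} (by simp [posetRank_top_lowerSet, hpos, hlt])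
    rw [flagHVector_singleton hinj] at this
    omega
  · refine ((Set.ncard_le_one_iff (Set.toFinite _)).2 fun {I J} hI hJ => ?_).trans one_le_two
    have h0 : ∀ K : LowerSet Q, posetRank K = Nat.card Q → K = ⊤ := fun K hK =>
      hinj _ _ le_top (hK.trans posetRank_top_lowerSet.symm)
    exact (h0 I hI).trans (h0 J hJ).symm

theorem Encodes.idealsMultiplicityFree {Q : Type*} [PartialOrder Q] {e : Q → ℕ} {n : ℕ}
    {p : ℕ → ℕ} (h : Encodes e n p) (hp : OmissionSeq p) : IdealsMultiplicityFree Q := by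
  have := h.finite
  have hcard : Nat.card Q = n := by
    have h1 := h.ncard_initial le_rfl
    rwa [show h.initial n = ⊤ from top_unique fun x _ => h.lt x, LowerSet.coe_top,
      Set.ncard_univ] at h1
  intro S hS
  rw [posetRank_top_lowerSet, hcard] at hS
  rw [h.flagHVector_eq hp fun s hs => (Finset.mem_Ioo.1 (hS hs)).2]
  split_ifs <;> simp

theorem idealsMultiplicityFree_tfae (Q : Type*) [PartialOrder Q] [Finite Q] :
    List.TFAE [
      IdealsMultiplicityFree Q,
      ∀ i ≤ Nat.card Q, {I : LowerSet Q | posetRank I = i}.ncard ≤ 2,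
      ∀ i ≤ Nat.card Q, {I : LowerSet Q | (I : Set Q).ncard = i}.ncard ≤ 2,
      TwoPlusTwoFree Q ∧ OnePlusOnePlusOneFree Q] := by
  tfae_have 1 → 2 := fun h i hi => h.ncard_le_two hi
  tfae_have 2 ↔ 3 := by simp only [posetRank_lowerSet]
  tfae_have 3 → 4 := fun h =>
    ⟨twoPlusTwoFree_of_ncard_le_two h, onePlusOnePlusOneFree_of_ncard_le_two h⟩
  tfae_have 4 → 1 := fun h => by
    obtain ⟨p, hp, e, he⟩ := exists_encodes h.1 h.2
    exact he.idealsMultiplicityFree (omissionSeq_of_mem_codes hp)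
  tfae_finish

theorem IdealsMultiplicityFree.exists_encodes {Q : Type*} [PartialOrder Q] [Finite Q]
    (h : IdealsMultiplicityFree Q) :
    ∃ p ∈ codes (Nat.card Q), ∃ e : Q → ℕ, Encodes e (Nat.card Q) p :=
  have h' : TwoPlusTwoFree Q ∧ OnePlusOnePlusOneFree Q :=
    ((idealsMultiplicityFree_tfae Q).out 0 3).1 h
  _root_.exists_encodes h'.1 h'.2

theorem IdealsMultiplicityFree.isSparse {Q : Type*} [PartialOrder Q] [Finite Q]
    (h : IdealsMultiplicityFree Q) {S : Finset ℕ} (hS : S ⊆ Finset.Ioo 0 (Nat.card Q))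
    (hne : flagHVector (LowerSet Q) S ≠ 0) : IsSparse S := by
  obtain ⟨p, hp, e, he⟩ := h.exists_encodes
  rw [he.flagHVector_eq (omissionSeq_of_mem_codes hp)
    fun s hs => (Finset.mem_Ioo.1 (hS hs)).2] at hne
  by_contra hcon
  exact hne (if_neg fun hd => hcon hd.isSparse)

/-! ### Ordinal sums and ranks with a single ideal -/

section ordinalSum

variable {Q : Type u} [PartialOrder Q] [Finite Q]

theorem exists_ncard_eq {i : ℕ} (hi : i ≤ Nat.card Q) :
    ∃ I : LowerSet Q, (I : Set Q).ncard = i := by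
  obtain ⟨I, -, -, hI⟩ := LowerSet.exists_ncard_eq_of_le i (⊥ : LowerSet Q) ⊤ bot_le
    (by simp) (by simpa using hi)
  exact ⟨I, hI⟩

/-- If there is only one ideal of some size, all of its elements lie below all the others. -/
theorem LowerSet.lt_of_unique {I : LowerSet Q}
    (hI : ∀ J : LowerSet Q, (J : Set Q).ncard = (I : Set Q).ncard → J = I) {x y : Q}
    (hx : x ∈ I) (hy : y ∉ I) : x < y := by
  by_contra hlt
  have hle : ¬ x ≤ y := fun h => hlt (lt_of_le_of_ne h (by rintro rfl; exact hy hx))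
  -- `K` is the largest ideal avoiding `x`, and it contains the principal ideal of `y`. Depending on
  -- the size of the latter, one can enlarge it to an ideal of the size of `I` that contains `y`, or
  -- find one of that size inside `K` that avoids `x`. Either differs from `I`.
  set K : LowerSet Q := (UpperSet.Ici x).compl
  have hK : ∀ z, z ∈ K ↔ ¬ x ≤ z := fun z => by simp [K]
  have hyK : LowerSet.Iic y ≤ K := fun z hz => (hK z).2 fun h => hle (h.trans hz)
  rcases le_total ((LowerSet.Iic y : LowerSet Q) : Set Q).ncard (I : Set Q).ncard with h1 | h1
  · obtain ⟨J, h2, -, h3⟩ := LowerSet.exists_ncard_eq_of_le _ (LowerSet.Iic y) ⊤ le_top h1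
      (by simpa using Set.ncard_le_card _)
    exact hy (hI J h3 ▸ h2 (by simp : y ∈ LowerSet.Iic y))
  · obtain ⟨J, -, h2, h3⟩ := LowerSet.exists_ncard_eq_of_le (I : Set Q).ncard ⊥ K bot_le
      (by simp) (h1.trans (Set.ncard_le_ncard hyK))
    exact (hK x).1 (h2 (hI J h3 ▸ hx)) le_rfl

/-- An ideal not contained in the lower summand has an element above that whole summand, hence
contains it; so no other ideal has the same size. Conversely, a unique ideal of its size is a lower
summand by `LowerSet.lt_of_unique`. -/
theorem isNontrivialOrdinalSum_iff :
    IsNontrivialOrdinalSum Q ↔ ∃ i, 1 ≤ i ∧ i < Nat.card Q ∧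
      {I : LowerSet Q | (I : Set Q).ncard = i}.ncard = 1 := by
  constructor
  · rintro ⟨A, B, _, _, hA, ⟨b⟩, ⟨f⟩⟩
    have hfin : Finite (A ⊕ₗ B) := Finite.of_equiv _ f.toEquiv
    let I : LowerSet Q := ⟨{x | ∃ a, f x = Sum.inlₗ a}, fun x y hyx ⟨a, hx⟩ => by
      have h1 := f.monotone hyx
      rw [hx] at h1
      rcases hy : ofLex (f y) with a' | b'
      · exact ⟨a', hy⟩
      · have hy' : f y = Sum.inrₗ b' := hy
        rw [hy'] at h1
        exact absurd h1 Sum.Lex.not_inr_le_inl⟩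
    have hI : ∀ x, x ∈ (I : Set Q) ↔ ∃ a, f x = Sum.inlₗ a := fun _ => Iff.rfl
    have hnot : ∀ x ∉ (I : Set Q), ∃ b, f x = Sum.inrₗ b := fun x hx => by
      rcases hy : ofLex (f x) with a' | b'
      · exact absurd ⟨a', hy⟩ hx
      · exact ⟨b', hy⟩
    have hlt : ∀ x ∈ (I : Set Q), ∀ y ∉ (I : Set Q), x < y := fun x hx y hy => by
      obtain ⟨a, ha⟩ := hx
      obtain ⟨b, hb⟩ := hnot y hy
      rw [← f.lt_iff_lt, ha, hb]
      exact Sum.Lex.inl_lt_inr _ _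
    obtain ⟨a⟩ := hA
    have haI : f.symm (Sum.inlₗ a) ∈ (I : Set Q) := ⟨a, by simp⟩
    have hbI : f.symm (Sum.inrₗ b) ∉ (I : Set Q) := fun ⟨a', ha'⟩ => by
      simp [Sum.inlₗ, Sum.inrₗ] at ha'
    refine ⟨(I : Set Q).ncard, (Set.ncard_pos (Set.toFinite _)).2 ⟨_, haI⟩, ?_,
      Set.ncard_eq_one.2 ⟨I, ?_⟩⟩
    · rw [← Set.ncard_univ]
      exact Set.ncard_lt_ncard ⟨Set.subset_univ _, fun h => hbI (h trivial)⟩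
    · ext J
      refine ⟨fun hJ => ?_, fun hJ => by rw [Set.mem_singleton_iff.1 hJ]; rfl⟩
      have hJc : (J : Set Q).ncard = (I : Set Q).ncard := hJ
      rw [Set.mem_singleton_iff]
      by_cases hsub : J ≤ I
      · exact LowerSet.eq_of_le_of_ncard_le hsub hJc.ge
      · obtain ⟨y, hyJ, hyI⟩ := Set.not_subset.1 hsub
        exact (LowerSet.eq_of_le_of_ncard_le (fun x hx => J.lower (hlt x hx y hyI).le hyJ)
          hJc.le).symm
  · classical
    rintro ⟨i, hi1, hi2, hi⟩
    obtain ⟨I, hI⟩ := Set.ncard_eq_one.1 hi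
    have hIi : (I : Set Q).ncard = i := by
      have : I ∈ {I : LowerSet Q | (I : Set Q).ncard = i} := hI ▸ rfl
      exact this
    have hlt : ∀ {x y : Q}, x ∈ I → y ∉ I → x < y := fun hx hy =>
      LowerSet.lt_of_unique (fun J hJ => by
        have : J ∈ {I : LowerSet Q | (I : Set Q).ncard = i} := hJ.trans hIi
        rwa [hI] at this) hx hy
    have hne1 : (I : Set Q).Nonempty := Set.nonempty_of_ncard_ne_zero (by omega)
    have hne2 : ∃ y, y ∉ I := by
      by_contra! hall
      rw [show (I : Set Q) = Set.univ from Set.eq_univ_of_forall hall, Set.ncard_univ] at hIi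
      omega
    refine ⟨{x // x ∈ I}, {x // x ∉ I}, inferInstance, inferInstance, hne1.to_subtype,
      ⟨⟨_, hne2.choose_spec⟩⟩, ⟨?_⟩⟩
    refine OrderIso.symm ⟨ofLex.trans (Equiv.sumCompl (· ∈ I)), ?_⟩
    intro a b
    rcases a with ⟨a, ha⟩ | ⟨a, ha⟩ <;> rcases b with ⟨b, hb⟩ | ⟨b, hb⟩
    · exact (Sum.Lex.inl_le_inl_iff (a := (⟨a, ha⟩ : {x // x ∈ I})) (b := ⟨b, hb⟩)).symm
    · exact iff_of_true (hlt ha hb).le (Sum.Lex.inl_le_inr _ _)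
    · exact iff_of_false (hlt hb ha).not_ge Sum.Lex.not_inr_le_inl
    · exact (Sum.Lex.inr_le_inr_iff (a := (⟨a, ha⟩ : {x // x ∉ I})) (b := ⟨b, hb⟩)).symm

theorem IdealsMultiplicityFree.not_isNontrivialOrdinalSum_iff (h : IdealsMultiplicityFree Q) :
    ¬ IsNontrivialOrdinalSum Q ↔ ∀ i : ℕ, 1 ≤ i → i < Nat.card Q →
      {I : LowerSet Q | posetRank I = i}.ncard = 2 := by
  rw [isNontrivialOrdinalSum_iff]
  push Not
  refine forall₃_congr fun i _ hi => ?_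
  have h2 := h.ncard_le_two hi.le
  simp only [posetRank_lowerSet] at h2 ⊢
  have h0 : {I : LowerSet Q | (I : Set Q).ncard = i}.ncard ≠ 0 := by
    obtain ⟨I, hI⟩ := exists_ncard_eq hi.le
    exact Set.ncard_ne_zero_of_mem (a := I) hI
  omega

end ordinalSum

/-! ### Codes classify the posets up to isomorphism -/

namespace Encodes

variable {Q : Type*} [PartialOrder Q] {e : Q → ℕ} {n : ℕ} {p : ℕ → ℕ}

theorem comp_orderIso {R : Type*} [PartialOrder R] (h : Encodes e n p) (f : R ≃o Q) :
    Encodes (e ∘ f) n p where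
  inj := h.inj.comp f.injective
  lt x := h.lt _
  surj k hk := by
    obtain ⟨x, hx⟩ := h.surj k hk
    exact ⟨f.symm x, by simp [hx]⟩
  lt_iff x y := by rw [← f.lt_iff_lt, h.lt_iff]; rfl

theorem nonempty_orderIso {R : Type*} [PartialOrder R] {e' : R → ℕ} (h : Encodes e n p)
    (h' : Encodes e' n p) : Nonempty (Q ≃o R) := by
  choose g hg using fun x => h'.surj (e x) (h.lt x)
  have hbij : Function.Bijective g := by
    refine ⟨fun x y hxy => h.inj ?_, fun y => ?_⟩
    · rw [← hg x, ← hg y, hxy]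
    · obtain ⟨x, hx⟩ := h.surj (e' y) (h'.lt y)
      exact ⟨x, h'.inj ((hg x).trans hx)⟩
  refine ⟨⟨Equiv.ofBijective g hbij, ?_⟩⟩
  intro x y
  rw [le_iff_lt_or_eq, le_iff_lt_or_eq, h.lt_iff, h'.lt_iff]
  simp only [Equiv.ofBijective_apply, hg, hbij.1.eq_iff]

/-- This expresses a feature of the code through J(Q) alone. Canonicity enters when `p (k + 2) = k`:
then the value is repeated, so `p k < k`, and the two punctured ideals are not comparable. -/
theorem exists_not_le_iff (h : Encodes e n p) (hp : p ∈ codes n) {k : ℕ} (hk : k + 2 < n) :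
    (∃ I J : LowerSet Q, (I : Set Q).ncard = k ∧ (J : Set Q).ncard = k + 2 ∧ ¬ I ≤ J) ↔
      p (k + 2) < k + 1 := by
  have hp' := omissionSeq_of_mem_codes hp
  constructor
  · rintro ⟨I, J, hI, hJ, hIJ⟩
    by_contra! hge
    have hkk : k < k + 2 := by omega
    apply hIJ
    rcases h.eq_initial_or_punctured hp' I hI with rfl | ⟨-, rfl⟩ <;>
      rcases h.eq_initial_or_punctured hp' J hJ with rfl | ⟨-, rfl⟩
    · exact h.initial_le_initial hkk.le
    · exact (h.initial_le_punctured_iff hp' hkk hk).2 (by omega)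
    · exact h.punctured_le_initial hp' hkk
    · exact (h.punctured_le_punctured_iff hp' hkk hk).2 (by omega)
  · intro hlt
    by_cases hpk : p (k + 2) = k
    · refine ⟨h.punctured hp' k, h.punctured hp' (k + 2), h.ncard_punctured hp' (by omega),
        h.ncard_punctured hp' hk, ?_⟩
      rw [h.punctured_le_punctured_iff hp' (by omega) hk]
      have := hp.2.2.1 k
      omega
    · refine ⟨h.initial k, h.punctured hp' (k + 2), h.ncard_initial (by omega),
        h.ncard_punctured hp' hk, ?_⟩
      rw [h.initial_le_punctured_iff hp' (by omega) hk]
      omega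

/-- Two invariants of J(Q), whether rank `k` has two ideals and whether ranks `k` and `k + 2`
contain a non-inclusion, decide which of the three allowed values `p` takes at each step. -/
theorem code_unique {e' : Q → ℕ} {p' : ℕ → ℕ} (h : Encodes e n p) (hp : p ∈ codes n)
    (h' : Encodes e' n p') (hp' : p' ∈ codes n) : p = p' := by
  have key : ∀ k, p k = p' k ∧ p (k + 1) = p' (k + 1) := by
    have hlt : ∀ k < n, p k < k ↔ p' k < k := fun k hk => by
      rw [h.lt_iff_ncard_lowerSets_eq_two (omissionSeq_of_mem_codes hp) hk,
        h'.lt_iff_ncard_lowerSets_eq_two (omissionSeq_of_mem_codes hp') hk]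
    have hstep : ∀ k, k + 2 < n → (p (k + 2) < k + 1 ↔ p' (k + 2) < k + 1) := fun k hk => by
      rw [← h.exists_not_le_iff hp hk, ← h'.exists_not_le_iff hp' hk]
    obtain ⟨a0, a1, a2, a3⟩ := hp
    obtain ⟨b0, b1, b2, b3⟩ := hp'
    intro k
    induction k with
    | zero =>
      refine ⟨a0.trans b0.symm, ?_⟩
      rw [zero_add]
      by_cases h1 : 1 < n
      · have := hlt 1 h1
        omega
      · rw [a3 1 (by omega), b3 1 (by omega)]
    | succ k ih =>
      refine ⟨ih.2, ?_⟩
      rw [add_assoc, one_add_one_eq_two]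
      by_cases h1 : k + 2 < n
      · have := hlt _ h1
        have := hstep k h1
        have := a2 k
        have := b2 k
        omega
      · rw [a3 _ (by omega), b3 _ (by omega)]
  exact funext fun k => (key k).1

end Encodes

/-- The partial order on `{0, …, n - 1}` with omission sequence `p`. -/
abbrev codeOrder (n : ℕ) (p : ℕ → ℕ) (hp : OmissionSeq p) : PartialOrder (Fin n) where
  le a b := a = b ∨ (a : ℕ) < b ∧ (a : ℕ) ≠ p b
  lt a b := (a = b ∨ (a : ℕ) < b ∧ (a : ℕ) ≠ p b) ∧ ¬ (b = a ∨ (b : ℕ) < a ∧ (b : ℕ) ≠ p a)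
  le_refl a := Or.inl rfl
  le_trans a b c hab hbc := by
    rcases hab with rfl | ⟨h1, h2⟩
    · exact hbc
    · rcases hbc with rfl | ⟨h3, h4⟩
      · exact Or.inr ⟨h1, h2⟩
      · refine Or.inr ⟨h1.trans h3, fun h5 => h2 ?_⟩
        rw [h5, hp.eq_of_lt (h5 ▸ h1) h3.le]
  le_antisymm a b hab hba := by
    rcases hab with rfl | ⟨h1, -⟩
    · rfl
    · rcases hba with h | ⟨h2, -⟩
      · exact h.symm
      · omega

theorem encodes_codeOrder (n : ℕ) (p : ℕ → ℕ) (hp : OmissionSeq p) :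
    @Encodes (Fin n) (codeOrder n p hp) Fin.val n p := by
  let := codeOrder n p hp
  refine ⟨Fin.val_injective, fun x => x.2, fun k hk => ⟨⟨k, hk⟩, rfl⟩, fun x y => ?_⟩
  rw [lt_iff_le_and_ne]
  change (x = y ∨ (x : ℕ) < y ∧ (x : ℕ) ≠ p y) ∧ x ≠ y ↔ _
  constructor
  · rintro ⟨h | h, hne⟩
    · exact absurd h hne
    · exact h
  · exact fun h => ⟨Or.inr h, fun hxy => h.1.ne (congrArg _ hxy)⟩

/-- The orders `codeOrder n p` represent the isomorphism classes in question, each exactly once. -/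
theorem countPosetsUpToIso_eq {n : ℕ} {Φ : PartialOrder (Fin n) → Prop} {Ψ : (ℕ → ℕ) → Prop}
    (hΦ : ∀ P, Φ P ↔ ∃ p ∈ codes n, Ψ p ∧ ∃ e, @Encodes (Fin n) P e n p) :
    countPosetsUpToIso n Φ = {p ∈ codes n | Ψ p}.ncard := by
  symm
  refine Set.ncard_congr (fun p hp => Quotient.mk (posetIsoSetoid n)
    (codeOrder n p (omissionSeq_of_mem_codes hp.1))) ?_ ?_ ?_
  · exact fun p hp => ⟨_, (hΦ _).2 ⟨p, hp.1, hp.2, _, encodes_codeOrder n p _⟩, rfl⟩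
  · intro p q hp hq heq
    obtain ⟨f⟩ := Quotient.exact heq
    exact @Encodes.code_unique (Fin n) (codeOrder n p (omissionSeq_of_mem_codes hp.1)) _ _ _ _ _
      (encodes_codeOrder n p _) hp.1 (@Encodes.comp_orderIso (Fin n) (codeOrder n q
        (omissionSeq_of_mem_codes hq.1)) _ _ _ (Fin n) (codeOrder n p
        (omissionSeq_of_mem_codes hp.1)) (encodes_codeOrder n q _) f) hq.1
  · rintro _ ⟨P, hP, rfl⟩
    obtain ⟨p, hp, hpΨ, e, he⟩ := (hΦ P).1 hP
    exact ⟨p, ⟨hp, hpΨ⟩, Quotient.sound (@Encodes.nonempty_orderIso (Fin n)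
      (codeOrder n p (omissionSeq_of_mem_codes hp)) _ _ _ (Fin n) P _ (encodes_codeOrder n p _) he)⟩

theorem fCount_eq (n : ℕ) : fCount n = (codes n).ncard := by
  rw [fCount, countPosetsUpToIso_eq (Ψ := fun _ => True)]
  · simp
  · intro P
    constructor
    · intro h
      obtain ⟨p, hp, e, he⟩ := h.exists_encodes
      rw [Nat.card_fin] at hp he
      exact ⟨p, hp, trivial, e, he⟩
    · rintro ⟨p, hp, -, e, he⟩
      exact he.idealsMultiplicityFree (omissionSeq_of_mem_codes hp)

theorem gCount_eq (n : ℕ) :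
    gCount n = {p ∈ codes n | ∀ k, 1 ≤ k → k < n → p k < k}.ncard := by
  rw [gCount, countPosetsUpToIso_eq]
  intro P
  have key : ∀ p ∈ codes n, ∀ e : Fin n → ℕ, Encodes e n p →
      (¬ IsNontrivialOrdinalSum (Fin n) ↔ ∀ k, 1 ≤ k → k < n → p k < k) := by
    intro p hp e he
    have hp' := omissionSeq_of_mem_codes hp
    rw [(he.idealsMultiplicityFree hp').not_isNontrivialOrdinalSum_iff, Nat.card_fin]
    simp only [posetRank_lowerSet]
    exact forall₃_congr fun k _ hk => (he.lt_iff_ncard_lowerSets_eq_two hp' hk).symm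
  constructor
  · rintro ⟨h, hsum⟩
    obtain ⟨p, hp, e, he⟩ := h.exists_encodes
    rw [Nat.card_fin] at hp he
    exact ⟨p, hp, (key p hp e he).1 hsum, e, he⟩
  · rintro ⟨p, hp, hlt, e, he⟩
    exact ⟨he.idealsMultiplicityFree (omissionSeq_of_mem_codes hp), (key p hp e he).2 hlt⟩

/-! ### Recurrences for the numbers of codes -/

section count

theorem update_mem_codes_of_succ {n : ℕ} {p : ℕ → ℕ} (hp : p ∈ codes (n + 1)) :
    Function.update p n n ∈ codes n := by
  obtain ⟨h0, h1, h2, h3⟩ := hp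
  refine ⟨?_, ?_, fun k => ?_, fun k hk => ?_⟩
  · simp only [Function.update_apply]; split_ifs <;> omega
  · simp only [Function.update_apply]; split_ifs <;> omega
  · have := h2 k
    have h4 := h3 (k + 2)
    simp only [Function.update_apply]
    split_ifs <;> omega
  · have := h3 k
    simp only [Function.update_apply]
    split_ifs <;> omega

theorem update_update_of_mem_codes {n q : ℕ} {p : ℕ → ℕ} (hp : p ∈ codes n) :
    Function.update (Function.update p n q) n n = p := by
  rw [Function.update_idem, Function.update_eq_self_iff, hp.2.2.2 n le_rfl]

theorem ncard_image_update {n : ℕ} {S : Set (ℕ → ℕ)} (hS : S ⊆ codes n) (f : (ℕ → ℕ) → ℕ) :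
    ((fun p => Function.update p n (f p)) '' S).ncard = S.ncard :=
  Set.InjOn.ncard_image fun p hp q hq h => by
    rw [← update_update_of_mem_codes (hS hp) (q := f p),
      ← update_update_of_mem_codes (hS hq) (q := f q)]
    exact congrArg (fun r => Function.update r n n) h

theorem codes_zero : codes 0 = {id} := by
  ext p
  refine ⟨fun hp => funext fun k => hp.2.2.2 k (Nat.zero_le k), ?_⟩
  rintro rfl
  exact ⟨rfl, Or.inl rfl, fun k => Or.inl rfl, fun _ _ => rfl⟩

theorem codes_one : codes 1 = {id} := by
  ext p
  refine ⟨fun hp => funext fun k => ?_, ?_⟩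
  · rcases k with _ | k
    · exact hp.1
    · exact hp.2.2.2 _ (Nat.succ_le_succ (Nat.zero_le k))
  · rintro rfl
    exact ⟨rfl, Or.inl rfl, fun k => Or.inl rfl, fun _ _ => rfl⟩

/-- The codes in which the two last elements omit a smaller one. -/
def codesLastTwo (n : ℕ) : Set (ℕ → ℕ) :=
  {p ∈ codes (n + 2) | p (n + 1) < n + 1 ∧ p n < n}

/-- The three parts: the last element omits nothing; it omits something but its predecessor does
not, which forces the value `n`; both omit a smaller element. -/
theorem codes_add_two (n : ℕ) : codes (n + 2) =
    codes (n + 1) ∪ ((fun p => Function.update p (n + 1) n) '' codes n ∪ codesLastTwo n) := by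
  ext p
  constructor
  · intro hp
    have hp' := omissionSeq_of_mem_codes hp
    rcases (hp'.le_self (n + 1)).eq_or_lt with h1 | h1
    · left
      have := update_mem_codes_of_succ hp
      rwa [Function.update_eq_self_iff.2 h1.symm] at this
    · right
      rcases (hp'.le_self n).eq_or_lt with h2 | h2
      · left
        have h3 := update_mem_codes_of_succ hp
        have h4 := update_mem_codes_of_succ h3
        rw [Function.update_eq_self_iff.2 (by rw [Function.update_of_ne (by omega), h2])] at h4
        refine ⟨_, h4, ?_⟩
        dsimp only
        rw [Function.update_idem, Function.update_eq_self_iff]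
        rcases hp'.succ n with h | h | h <;> omega
      · exact Or.inr ⟨hp, h1, h2⟩
  · rintro (hp | ⟨p, hp, rfl⟩ | hp)
    · exact codes_mono (Nat.le_succ _) hp
    · exact update_mem_codes (codes_mono (Nat.le_succ _) hp) (Or.inr (Or.inl rfl))
    · exact hp.1

/-- The three parts are the three allowed values of `p (n + 2)`. Repetition is available exactly on
`codesLastTwo n`. -/
theorem codes_add_three (n : ℕ) : codes (n + 3) =
    codes (n + 2) ∪ ((fun p => Function.update p (n + 2) (n + 1)) '' codes (n + 2) ∪
      (fun p => Function.update p (n + 2) (p (n + 1))) '' codesLastTwo n) := by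
  ext p
  constructor
  · intro hp
    have h3 := update_mem_codes_of_succ hp
    have h4 : ∀ q, p (n + 2) = q →
        Function.update (Function.update p (n + 2) (n + 2)) (n + 2) q = p := fun q hq => by
      rw [Function.update_idem, Function.update_eq_self_iff, hq]
    rcases hp.2.2.1 n with h | h | ⟨h, h5, h6⟩
    · left
      rwa [Function.update_eq_self_iff.2 h.symm] at h3
    · exact Or.inr (Or.inl ⟨_, h3, h4 _ h⟩)
    · refine Or.inr (Or.inr ⟨_, ⟨h3, ?_, ?_⟩, ?_⟩)
      · rwa [Function.update_of_ne (by omega)]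
      · rwa [Function.update_of_ne (by omega)]
      · dsimp only
        exact h4 _ (by rw [h, Function.update_of_ne (by omega)])
  · rintro (hp | ⟨p, hp, rfl⟩ | ⟨p, hp, rfl⟩)
    · exact codes_mono (Nat.le_succ _) hp
    · exact update_mem_codes hp (Or.inr (Or.inl rfl))
    · exact update_mem_codes hp.1 (Or.inr (Or.inr ⟨n, rfl, rfl, hp.2.1, hp.2.2⟩))

theorem codes_two : codes 2 = {id, Function.update id 1 0} := by
  have : codesLastTwo 0 = ∅ := Set.eq_empty_of_forall_notMem fun p hp => absurd hp.2.2 (by omega)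
  rw [codes_add_two, this, codes_zero, codes_one]
  simp only [Set.image_singleton, Set.union_empty]
  rfl

theorem finite_codes (n : ℕ) : (codes n).Finite := by
  induction n using Nat.strong_induction_on with
  | _ n ih =>
    rcases n with _ | _ | _ | n
    · simp [codes_zero]
    · simp [codes_one]
    · simp [codes_two]
    · rw [codes_add_three]
      have h := ih (n + 2) (by omega)
      exact h.union ((h.image _).union ((h.subset fun p hp => hp.1).image _))

theorem ncard_codes_add_two (n : ℕ) :
    (codes (n + 2)).ncard = (codes (n + 1)).ncard + ((codes n).ncard + (codesLastTwo n).ncard) := by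
  have h0 := finite_codes (n + 2)
  have hl : (codesLastTwo n).Finite := h0.subset fun p hp => hp.1
  have hi := (finite_codes n).image fun p => Function.update p (n + 1) n
  rw [codes_add_two, Set.ncard_union_eq _ (finite_codes _) (hi.union hl),
    Set.ncard_union_eq _ hi hl]
  · congr 2
    refine Set.InjOn.ncard_image fun p hp q hq h => ?_
    have hp' := codes_mono (Nat.le_succ n) hp
    have hq' := codes_mono (Nat.le_succ n) hq
    rw [← update_update_of_mem_codes hp' (q := n), ← update_update_of_mem_codes hq' (q := n)]
    exact congrArg (fun r => Function.update r (n + 1) (n + 1)) h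
  · rw [Set.disjoint_left]
    rintro _ ⟨p, hp, rfl⟩ h
    have h1 := h.2.2
    dsimp only at h1
    rw [Function.update_of_ne (by omega), hp.2.2.2 n le_rfl] at h1
    omega
  · rw [Set.disjoint_left]
    intro q hq h
    have h1 := hq.2.2.2 (n + 1) le_rfl
    rcases h with ⟨p, hp, rfl⟩ | h
    · simp at h1
    · have := h.2.1
      omega

theorem ncard_codes_add_three (n : ℕ) :
    (codes (n + 3)).ncard =
      (codes (n + 2)).ncard + ((codes (n + 2)).ncard + (codesLastTwo n).ncard) := by
  have h0 := finite_codes (n + 2)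
  have hl : (codesLastTwo n).Finite := h0.subset fun p hp => hp.1
  have hi := h0.image fun p => Function.update p (n + 2) (n + 1)
  have hj := hl.image fun p => Function.update p (n + 2) (p (n + 1))
  rw [codes_add_three, Set.ncard_union_eq _ h0 (hi.union hj), Set.ncard_union_eq _ hi hj,
    ncard_image_update le_rfl fun _ => n + 1,
    ncard_image_update (fun p hp => hp.1) fun p => p (n + 1)]
  · rw [Set.disjoint_left]
    rintro _ ⟨p, hp, rfl⟩ ⟨q, hq, h⟩
    have h1 := congrFun h (n + 2)
    simp only [Function.update_self] at h1
    have := hq.2.1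
    omega
  · rw [Set.disjoint_left]
    intro r hr h
    have h1 := hr.2.2.2 (n + 2) le_rfl
    rcases h with ⟨p, hp, rfl⟩ | ⟨p, hp, rfl⟩
    · simp at h1
    · have := hp.2.1
      simp at h1
      omega

theorem fCount_zero : fCount 0 = 1 := by simp [fCount_eq, codes_zero]

theorem fCount_one : fCount 1 = 1 := by simp [fCount_eq, codes_one]

theorem fCount_two : fCount 2 = 2 := by
  rw [fCount_eq, codes_two, Set.ncard_pair]
  intro h
  simpa using congrFun h 1

/-- Eliminate the cardinality of `codesLastTwo n` from the two decompositions. -/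
theorem fCount_add_three (n : ℕ) :
    fCount (n + 3) + fCount (n + 1) + fCount n = 3 * fCount (n + 2) := by
  simp only [fCount_eq]
  have := ncard_codes_add_two n
  have := ncard_codes_add_three n
  omega

theorem mk_fCount : PowerSeries.mk (fun n : ℕ => (fCount n : ℚ)) =
    (1 - 2 * PowerSeries.X) *
      ((1 - PowerSeries.X) * (1 - 2 * PowerSeries.X - PowerSeries.X ^ 2))⁻¹ := by
  rw [PowerSeries.eq_mul_inv_iff_mul_eq (by simp)]
  set F : PowerSeries ℚ := PowerSeries.mk (fun n : ℕ => (fCount n : ℚ))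
  have hF : ∀ n, PowerSeries.coeff n F = fCount n := fun n => PowerSeries.coeff_mk _ _
  have hF0 : PowerSeries.constantCoeff F = 1 := by
    rw [← PowerSeries.coeff_zero_eq_constantCoeff_apply, hF, fCount_zero, Nat.cast_one]
  -- The denominator is $1-3x+x^2+x^3$. Sums and repeated right factors `X` put the product in a
  -- form in which coefficients can be read off by shifting.
  have h1 : F * ((1 - PowerSeries.X) * (1 - 2 * PowerSeries.X - PowerSeries.X ^ 2)) =
      F - (F + F + F) * PowerSeries.X + F * PowerSeries.X * PowerSeries.X +
        F * PowerSeries.X * PowerSeries.X * PowerSeries.X := by ring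
  have h2 : (1 : PowerSeries ℚ) - 2 * PowerSeries.X =
      1 - PowerSeries.X - PowerSeries.X := by ring
  rw [h1, h2]
  ext n
  rcases n with _ | _ | _ | n
  · simp [hF0]
  · simp [hF, hF0, fCount_one, PowerSeries.coeff_succ_mul_X, PowerSeries.coeff_one]
    norm_num
  · simp [hF, fCount_zero, fCount_one, fCount_two, PowerSeries.coeff_succ_mul_X,
      PowerSeries.coeff_one, PowerSeries.coeff_X]
    norm_num
  · have := fCount_add_three n
    have h3 : (fCount (n + 3) + fCount (n + 1) + fCount n : ℚ) = 3 * fCount (n + 2) := by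
      exact_mod_cast this
    simp [hF, PowerSeries.coeff_succ_mul_X, PowerSeries.coeff_one, PowerSeries.coeff_X]
    linarith

/-- The codes of the posets that are not nontrivial ordinal sums. -/
def irreducibleCodes (n : ℕ) : Set (ℕ → ℕ) :=
  {p ∈ codes n | ∀ k, 1 ≤ k → k < n → p k < k}

theorem gCount_one : gCount 1 = 1 := by
  rw [gCount_eq, codes_one, Set.ncard_eq_one]
  refine ⟨id, Set.ext fun p => ⟨And.left, fun h => ⟨h, fun k _ _ => by omega⟩⟩⟩

theorem gCount_two : gCount 2 = 1 := by
  rw [gCount_eq, codes_two, Set.ncard_eq_one]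
  refine ⟨Function.update id 1 0, Set.ext fun p => ⟨?_, ?_⟩⟩
  · rintro ⟨rfl | h, hlt⟩
    · exact absurd (hlt 1 le_rfl one_lt_two) (lt_irrefl _)
    · exact h
  · rintro rfl
    refine ⟨Or.inr rfl, fun k hk hk2 => ?_⟩
    obtain rfl : k = 1 := by omega
    simp

/-- The doubling does not start yet: repetition at index 2 would need `p 0 < 0`. -/
theorem gCount_three : gCount 3 = 1 := by
  rw [gCount_eq, Set.ncard_eq_one]
  refine ⟨fun k => if k = 1 then 0 else if k = 2 then 1 else k, Set.ext fun p => ⟨?_, ?_⟩⟩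
  · rintro ⟨⟨h0, h1, h2, h3⟩, hlt⟩
    refine funext fun k => ?_
    have a1 := hlt 1 le_rfl (by omega)
    have a2 := hlt 2 (by omega) (by omega)
    have a3 := h2 0
    split_ifs with hk hk
    · subst hk; omega
    · subst hk; simp at a3; omega
    · rcases Nat.eq_zero_or_pos k with rfl | hpos
      · exact h0
      · exact h3 k (by omega)
  · rintro rfl
    refine ⟨⟨by simp, by simp, fun k => ?_, fun k hk => ?_⟩, fun k hk hk2 => ?_⟩
    · dsimp only
      split_ifs <;> omega
    · dsimp only
      split_ifs <;> omega
    · dsimp only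
      split_ifs <;> omega

/-- Every element but the first omits a smaller one, so the new element can omit its predecessor or
repeat the previous omission. The two choices differ because `p (n + 2) < n + 2`. -/
theorem gCount_add_four (n : ℕ) : gCount (n + 4) = 2 * gCount (n + 3) := by
  rw [gCount_eq, gCount_eq]
  change (irreducibleCodes _).ncard = 2 * (irreducibleCodes _).ncard
  have hsub : irreducibleCodes (n + 3) ⊆ codes (n + 3) := fun p hp => hp.1
  have h0 := (finite_codes (n + 3)).subset hsub
  have hup : ∀ {p q}, p ∈ irreducibleCodes (n + 3) → q < n + 3 →
      Function.update p (n + 3) q ∈ codes (n + 4) →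
      Function.update p (n + 3) q ∈ irreducibleCodes (n + 4) := fun {p q} hp hq h =>
    ⟨h, fun k hk hk2 => by
      have := hp.2 k hk
      simp only [Function.update_apply]
      split_ifs <;> omega⟩
  have heq : irreducibleCodes (n + 4) =
      (fun p => Function.update p (n + 3) (n + 2)) '' irreducibleCodes (n + 3) ∪
      (fun p => Function.update p (n + 3) (p (n + 2))) '' irreducibleCodes (n + 3) := by
    ext p
    constructor
    · rintro ⟨hp, hlt⟩
      have h3 : Function.update p (n + 3) (n + 3) ∈ irreducibleCodes (n + 3) :=
        ⟨update_mem_codes_of_succ hp, fun k hk hk2 => by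
          rw [Function.update_of_ne (by omega)]
          exact hlt k hk (by omega)⟩
      have h4 : ∀ q, p (n + 3) = q →
          Function.update (Function.update p (n + 3) (n + 3)) (n + 3) q = p := fun q hq => by
        rw [Function.update_idem, Function.update_eq_self_iff, hq]
      have h6 := hlt (n + 3) (by omega) (by omega)
      rcases hp.2.2.1 (n + 1) with h | h | h
      · exact absurd h6 (by rw [show n + 3 = n + 1 + 2 from rfl, h]; omega)
      · exact Or.inl ⟨_, h3, h4 _ h⟩
      · refine Or.inr ⟨_, h3, ?_⟩
        dsimp only
        exact h4 _ (by rw [Function.update_of_ne (by omega)]; exact h.1)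
    · rintro (⟨p, hp, rfl⟩ | ⟨p, hp, rfl⟩)
      · exact hup hp (by omega) (update_mem_codes hp.1 (Or.inr (Or.inl rfl)))
      · have h1 := hp.2 (n + 2) (by omega) (by omega)
        exact hup hp (by omega) (update_mem_codes hp.1 (Or.inr (Or.inr
          ⟨n + 1, rfl, rfl, h1, hp.2 (n + 1) (by omega) (by omega)⟩)))
  rw [heq, Set.ncard_union_eq _ (h0.image _) (h0.image _),
    ncard_image_update hsub fun _ => n + 2, ncard_image_update hsub fun p => p (n + 2), two_mul]
  rw [Set.disjoint_left]
  rintro _ ⟨p, hp, rfl⟩ ⟨q, hq, h⟩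
  have h1 := congrFun h (n + 3)
  simp only [Function.update_self] at h1
  have := hq.2 (n + 2) (by omega) (by omega)
  omega

theorem gCount_of_three_le {n : ℕ} (hn : 3 ≤ n) : gCount n = 2 ^ (n - 3) := by
  induction n, hn using Nat.le_induction with
  | base => exact gCount_three
  | succ n hn ih =>
    obtain ⟨m, rfl⟩ := Nat.exists_eq_add_of_le' hn
    rw [gCount_add_four, ih, show m + 3 + 1 - 3 = m + 3 - 3 + 1 by omega, pow_succ']

end count
end

theorem theorem3 :
    (∀ (Q : Type u) [PartialOrder Q] [Finite Q] (n : ℕ), Nat.card Q = n →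
      List.TFAE [
        IdealsMultiplicityFree Q,
        ∀ i ≤ n, {I : LowerSet Q | posetRank I = i}.ncard ≤ 2,
        ∀ i ≤ n, {I : LowerSet Q | (I : Set Q).ncard = i}.ncard ≤ 2,
        TwoPlusTwoFree Q ∧ OnePlusOnePlusOneFree Q] ∧
      (IdealsMultiplicityFree Q →
        ∀ S : Finset ℕ, S ⊆ Finset.Ioo 0 n → flagHVector (LowerSet Q) S ≠ 0 → IsSparse S) ∧
      (IdealsMultiplicityFree Q →
        (¬ IsNontrivialOrdinalSum Q ↔
          ∀ i : ℕ, 1 ≤ i → i < n → {I : LowerSet Q | posetRank I = i}.ncard = 2))) ∧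
    PowerSeries.mk (fun n : ℕ => (fCount n : ℚ)) =
      (1 - 2 * PowerSeries.X) *
        ((1 - PowerSeries.X) * (1 - 2 * PowerSeries.X - PowerSeries.X ^ 2))⁻¹ ∧
    gCount 1 = 1 ∧ gCount 2 = 1 ∧ ∀ n : ℕ, 3 ≤ n → gCount n = 2 ^ (n - 3) := by
  refine ⟨?_, mk_fCount, gCount_one, gCount_two, fun n hn => gCount_of_three_le hn⟩
  rintro Q _ _ _ rfl
  exact ⟨idealsMultiplicityFree_tfae Q, fun h S hS hne => h.isSparse hS hne,
    fun h => h.not_isNontrivialOrdinalSum_iff⟩
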